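/- **The type theory.** Core types are $S,T ::= \mathtt{Nat}\mid S\to T$. Types (of layer 1) are $S,T ::= \mathtt{Nat}\mid S\to T\mid \square(\Delta\vdash T)$, where in the contextual type $\square(\Delta\vdash T)$ both the local context $\Delta$ and $T$ are core. A global context $\Psi$ is a list of bindings $u:(\Delta\vdash T)$ with $\Delta$, $T$ core. A local context $\Gamma$ is a list of bindings $x:T$, with $T$ core at layer 0 and $T$ a type at layer 1. There are two typing judgments $\Psi;\Gamma\vdash_i t:T$, $i\in\{0,1\}$ (layer 0 is code, layer 1 is computation); terms are identified with their typing derivations (and variables with their positions). Both layers have: local variables $x$; $\mathsf{zero}$, $\mathsf{succ}\,t$; $\lambda x.t$ and $t\,s$; and $u^\delta:T$ for $u:(\Delta\vdash T)\in\Psi$ and a local substitution $\Psi;\Gamma\vdash_i\delta:\Delta$ (a term of layer $i$ of type $A$ for each $x:A\in\Delta$). Layer 1 has in addition: * $\mathsf{box}\,t:\square(\Delta\vdash T)$ whenever $\Psi;\Delta\vdash_0 t:T$; * $\mathsf{letbox}\;u=s\;\mathsf{in}\;t:T'$ whenever $\Psi;\Gamma\vdash_1 s:\square(\Delta\vdash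 T)$ and $\Psi,u:(\Delta\vdash T);\Gamma\vdash_1 t:T'$; * $\mathsf{match}\;s\;\vec b:T'$ whenever $\Psi;\Gamma\vdash_1 s:\square(\Delta\vdash T)$ and $\vec b$ consists of exactly one branch with body of type $T'$ (over $\Gamma$ and the extension of $\Psi$ by the pattern variables) for each of the patterns: $x$, for each $x:T\in\Delta$; $\mathsf{zero}$ and $\mathsf{succ}\,?u$ with $u:(\Delta\vdash\mathtt{Nat})$, if $T=\mathtt{Nat}$; $\lambda x.?u$ with $u:(\Delta,x{:}S_1\vdash S_2)$, if $T=S_1\to S_2$; and $?u\;?u'$. The body of the last branch is given for every core type $S$, with $u:(\Delta\vdash S\to T)$ and $u':(\Delta\vdash S)$; as derivations, it is an $S$-indexed family of bodies. Local substitution $t[\delta]$ and global substitution $t[\sigma]$ are the capture-avoiding ones, with $(\mathsf{box}\,t)[\delta]=\mathsf{box}\,t$, $(\mathsf{box}\,t)[\sigma]=\mathsf{box}(t[\sigma])$ and $u^\delta[\sigma]=\sigma(u)[\delta[\sigma]]$; here a global substitution $\Psi\vdash\sigma:\Phi$ assigns a term $\Psi;\Delta\vdash_0\sigma(u):T$ to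 each $u:(\Delta\vdash T)\in\Phi$. **Equivalence.** $\Psi;\Gamma\vdash_i s\approx t:T$ is the least symmetric and transitive relation that is closed under all the term formers of layer $i$ (with layer-0 equivalence under $\mathsf{box}$, and branchwise in $\mathsf{match}$) and, for $i=1$ only, contains the $\beta$ rules $(\lambda x.t)\,s\approx t[s/x]$; $\mathsf{letbox}\;u=\mathsf{box}\,s\;\mathsf{in}\;t\approx t[s/u]$; $\mathsf{match}\;(\mathsf{box}\,c)\;\vec b\approx$ the body of the branch whose pattern matches $c$ (for $c$ a local variable, $\mathsf{zero}$, $\mathsf{succ}\,s$, $\lambda x.s$, or $r\,s$, the branch $?u\,?u'$ being taken at the type of $s$) with the matched pieces of code substituted for the pattern variables; and the $\eta$ rule $t\approx\lambda x.(t\,x)$ at function types. **Normal forms** are the terms of layer 1 given by $$w ::= v\mid\mathsf{zero}\mid\mathsf{succ}\,w\mid\mathsf{box}\,c\mid\lambda x.w,\qquad v ::= x\mid u^\theta\mid v\,w\mid\mathsf{letbox}\;u=v\;\mathsf{in}\;w\mid\mathsf{match}\;v\;\vec r\mid\mathsf{match}\;(\mathsf{box}\,u^\delta)\;\vec r,$$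 with $c$ and $\delta$ of layer 0, and $\theta$, $\vec r$ composed of normal forms. $\mathrm{Nf}^T_{\Psi;\Gamma}$ and $\mathrm{Ne}^T_{\Psi;\Gamma}$ denote the sets of well-typed $w$ and $v$. **NbE.** A weakening $\gamma;\tau:\Phi;\Delta\Rightarrow\Psi;\Gamma$ is a pair of order-preserving embeddings of $\Psi$ into $\Phi$ and of $\Gamma$ into $\Delta$; $[\gamma;\tau]$ denotes its action on terms and on elements of the sets below. Let $[\![\mathtt{Nat}]\!]=\mathrm{Nf}^{\mathtt{Nat}}$, $[\![\square(\Delta\vdash T)]\!]=\mathrm{Nf}^{\square(\Delta\vdash T)}$, and let $[\![S\to T]\!]_{\Psi;\Gamma}$ be the families of maps $[\![S]\!]_{\Phi;\Delta}\to[\![T]\!]_{\Phi;\Delta}$ indexed by the weakenings $\Phi;\Delta\Rightarrow\Psi;\Gamma$. Reification $\downarrow^T:[\![T]\!]\to\mathrm{Nf}^T$ and reflection $\uparrow^T:\mathrm{Ne}^T\to[\![T]\!]$ are the identity and the inclusion unless $T$ is a function type, and $$\downarrow^{S\to T}(a)=\lambda x.\downarrow^T(a(p\,;\uparrow^S(x))),\qquad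 \uparrow^{S\to T}(v)(\gamma;\tau,a)=\uparrow^T(v[\gamma;\tau]\downarrow^S(a)),$$ with $p$ the weakening by $x$. An element $\rho$ of $[\![\Delta]\!]_{\Psi;\Gamma}$ assigns an element of $[\![A]\!]_{\Psi;\Gamma}$ to each $x:A\in\Delta$. At layer 0 a term $\Phi;\Delta\vdash_0 t:T$ is interpreted at a global weakening $\gamma:\Psi\Rightarrow\Phi$ and $\rho$, with $[\![u^\delta]\!]^0(\gamma;\rho)=\uparrow(u[\gamma]^\theta)$, $\theta=\downarrow([\![\delta]\!]^0(\gamma;\rho))$. At layer 1 it is interpreted at a global substitution $\Psi\vdash\sigma:\Phi$ and $\rho$, with * $[\![u^\delta]\!]^1(\sigma;\rho)=[\![\sigma(u)]\!]^0(\mathrm{id};[\![\delta]\!]^1(\sigma;\rho))$ and $[\![\mathsf{box}\,t]\!]^1(\sigma;\rho)=\mathsf{box}(t[\sigma])$; * $[\![\mathsf{letbox}\;u=s\;\mathsf{in}\;t]\!]^1(\sigma;\rho)=[\![t]\!]^1(\sigma,c/u;\rho)$ if $[\![s]\!]^1(\sigma;\rho)=\mathsf{box}\,c$, and $=\uparrow(\mathsf{letbox}\;u=v\;\mathsf{in}\;\downarrow[\![t]\!]^1(\sigma,u/u;\rho))$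 if it is a neutral $v$ (with $\sigma$, $\rho$ weakened by $u$); * $[\![\mathsf{match}\;s\;\vec b]\!]^1(\sigma;\rho)$ is, if $[\![s]\!]^1(\sigma;\rho)=\mathsf{box}\,c$ and $c$ matches a pattern, the interpretation of the body of that branch at $\sigma$ extended by the matched pieces of code; if $c=u^\delta$, it is $\uparrow(\mathsf{match}\;(\mathsf{box}\,u^\delta)\;\vec r)$; and if $[\![s]\!]^1(\sigma;\rho)$ is a neutral $v$, it is $\uparrow(\mathsf{match}\;v\;\vec r)$. Here $\vec r$ consists of the reified interpretations of the bodies of $\vec b$ at $\sigma$ extended by the pattern variables, for each $S$ in the branch $?u\;?u'$. On variables, $\mathsf{zero}$, $\mathsf{succ}$, $\lambda$ and application both interpretations are the standard ones of the simply typed $\lambda$-calculus. Finally, $\mathrm{nbe}^T_{\Psi;\Gamma}(t)=\downarrow^T([\![t]\!]^1(\mathrm{id};\uparrow^\Gamma))\in\mathrm{Nf}^T_{\Psi;\Gamma}$, where $\uparrow^\Gamma$ assigns to each variable its reflection. **Theorem (Soundness).** If $\Psi;\Gamma\vdash_1 t:T$, then $\Psi;\Gamma\vdash_1 t\approx\mathrm{nbe}^T_{\Psi;\Gamma}(t):T$.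 -/

import Mathlib

/-!
The 2-layered contextual modal type theory with pattern matching on code, its layer-0 and layer-1
equivalence, and its normalization by evaluation algorithm in a presheaf model over weakenings.

Terms are represented by their typing derivations (well-typed de Bruijn terms).  Well-formedness of
types and contexts is built in: `CTy` are the core types, `Ty` are the types of layer 1.  Contexts are
lists whose head is the most recently bound variable.
-/

namespace LayeredCMTT

/-! ### Types and contexts -/

/-- Core types: `S, T ::= Nat | S ⟶ T`. -/
inductive CTy : Type
  | nat : CTy
  | arr : CTy → CTy → CTy

/-- Local contexts of layer 0. -/
abbrev CCtx : Type := List CTy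

/-- Types of layer 1: `S, T ::= Nat | S ⟶ T | □(Δ ⊢ T)`, where in the contextual type
`□(Δ ⊢ T)` both `Δ` and `T` are core. -/
inductive Ty : Type
  | nat : Ty
  | arr : Ty → Ty → Ty
  | box : CCtx → CTy → Ty

/-- Every core type is a type of layer 1. -/
def CTy.emb : CTy → Ty
  | .nat => .nat
  | .arr S T => .arr S.emb T.emb

/-- Local contexts of layer 1. -/
abbrev Ctx : Type := List Ty

/-- A binding `u : (ctx ⊢ ty)` of a global context. -/
structure GBind : Type where
  ctx : CCtx
  ty : CTy

/-- Global contexts. -/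
abbrev GCtx : Type := List GBind

/-- `Var Γ a` is the type of (proof-relevant) memberships `x : a ∈ Γ`. -/
inductive Var {α : Type} : List α → α → Type
  | z {Γ : List α} {a : α} : Var (a :: Γ) a
  | s {Γ : List α} {a b : α} : Var Γ a → Var (b :: Γ) a

/-! ### Families indexed by the variables of a context

Substitutions `· | δ, t/x` and semantic environments are finite: they assign to each variable of a
context an object of the right type. -/

/-- One element of `X a` for each variable `x : a` of `Δ`. -/
abbrev Env {α : Type} (X : α → Type) (Δ : List α) : Type := (a : α) → Var Δ a → X a

def Env.nil {α : Type} {X : α → Type} : Env X [] := fun _ x => nomatch x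

def Env.cons {α : Type} {X : α → Type} {Δ : List α} {b : α} (ρ : Env X Δ) (v : X b) :
    Env X (b :: Δ)
  | _, .z => v
  | _, .s x => ρ _ x

/-! ### Weakenings -/

/-- Weakenings `Γ ⟹ Δ`, used for global as well as for local contexts:
`nil` is `ε`, `keep` is `q`, `drop` is `p`. -/
inductive Wk {α : Type} : List α → List α → Type
  | nil : Wk [] []
  | keep {Γ Δ : List α} {a : α} : Wk Γ Δ → Wk (a :: Γ) (a :: Δ)
  | drop {Γ Δ : List α} {a : α} : Wk Γ Δ → Wk (a :: Γ) Δ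

namespace Wk

variable {α : Type}

/-- The identity weakening. -/
def id : (Γ : List α) → Wk Γ Γ
  | [] => .nil
  | _ :: Γ => .keep (id Γ)

/-- Composition `γ' ∘ γ`. -/
def comp : {Γ Δ Θ : List α} → Wk Δ Θ → Wk Γ Δ → Wk Γ Θ
  | _, _, _, γ', .nil => γ'
  | _, _, _, γ', .drop γ => .drop (comp γ' γ)
  | _, _, _, .keep γ', .keep γ => .keep (comp γ' γ)
  | _, _, _, .drop γ', .keep γ => .drop (comp γ' γ)

/-- `q` iterated along a list of bindings. -/
def keeps : (l : List α) → {Γ Δ : List α} → Wk Γ Δ → Wk (l ++ Γ) (l ++ Δ)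
  | [], _, _, γ => γ
  | _ :: l, _, _, γ => .keep (keeps l γ)

/-- `p(⋯ p(id))` along a list of bindings. -/
def drops : (l : List α) → (Γ : List α) → Wk (l ++ Γ) Γ
  | [], Γ => id Γ
  | _ :: l, Γ => .drop (drops l Γ)

end Wk

/-- Action of a weakening on a variable. -/
def Var.wk {α : Type} : {Γ Δ : List α} → {a : α} → Wk Γ Δ → Var Δ a → Var Γ a
  | _, _, _, .keep _, .z => .z
  | _, _, _, .keep γ, .s x => .s (Var.wk γ x)
  | _, _, _, .drop γ, x => .s (Var.wk γ x)

/-! ### Terms of layer 0 -/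

/-- `Code Ψ Γ T` is the type of the terms `t` with `Ψ; Γ ⊢₀ t : T`.  In `gvar u δ`, that is `u^δ`,
`δ` is a local substitution of layer 0. -/
inductive Code (Ψ : GCtx) : CCtx → CTy → Type
  | var {Γ : CCtx} {T : CTy} : Var Γ T → Code Ψ Γ T
  | gvar {Γ Δ : CCtx} {T : CTy} (u : Var Ψ ⟨Δ, T⟩)
      (δ : (A : CTy) → Var Δ A → Code Ψ Γ A) : Code Ψ Γ T
  | zero {Γ : CCtx} : Code Ψ Γ .nat
  | succ {Γ : CCtx} : Code Ψ Γ .nat → Code Ψ Γ .nat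
  | lam {Γ : CCtx} {S T : CTy} : Code Ψ (S :: Γ) T → Code Ψ Γ (.arr S T)
  | app {Γ : CCtx} {S T : CTy} : Code Ψ Γ (.arr S T) → Code Ψ Γ S → Code Ψ Γ T

/-- Global substitutions `Ψ ⊢ σ : Φ`. -/
abbrev GSub (Ψ Φ : GCtx) : Type := Env (fun B : GBind => Code Ψ B.ctx B.ty) Φ

/-! ### Patterns and terms of layer 1 -/

/-- The patterns against which a scrutinee of type `□(Δ ⊢ T)` is matched: `var x` for each
`x : T ∈ Δ`; `zero` and `succ ?u` if `T` is `Nat`; `λ x. ?u` if `T` is a function type; and `?u ?u'`.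
The body of the branch `?u ?u' ⇒ t` has to be given for every core argument type `S`, so that this
branch is a family of branches `app S`. -/
inductive Pat : CCtx → CTy → Type
  | var {Δ : CCtx} {T : CTy} (x : Var Δ T) : Pat Δ T
  | zero {Δ : CCtx} : Pat Δ .nat
  | succ {Δ : CCtx} : Pat Δ .nat
  | lam {Δ : CCtx} {S T : CTy} : Pat Δ (.arr S T)
  | app {Δ : CCtx} {T : CTy} (S : CTy) : Pat Δ T

/-- The global variables bound by a pattern (the one bound last comes first). -/
def Pat.binds : {Δ : CCtx} → {T : CTy} → Pat Δ T → GCtx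
  | _, _, .var _ => []
  | _, _, .zero => []
  | Δ, _, .succ => [⟨Δ, .nat⟩]
  | Δ, .arr S T, .lam => [⟨S :: Δ, T⟩]
  | Δ, T, .app S => [⟨Δ, S⟩, ⟨Δ, .arr S T⟩]

/-- `Tm Ψ Γ T` is the type of the terms `t` with `Ψ; Γ ⊢₁ t : T`.  In `gvar u δ`, that is `u^δ`, `δ`
is a local substitution of layer 1.  In `matchbox s b` the covering collection `b` of branches is given
by its lookup function: exactly one branch for each pattern. -/
inductive Tm : GCtx → Ctx → Ty → Type
  | var {Ψ : GCtx} {Γ : Ctx} {T : Ty} : Var Γ T → Tm Ψ Γ T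
  | gvar {Ψ : GCtx} {Γ : Ctx} {Δ : CCtx} {T : CTy} (u : Var Ψ ⟨Δ, T⟩)
      (δ : (A : CTy) → Var Δ A → Tm Ψ Γ A.emb) : Tm Ψ Γ T.emb
  | zero {Ψ : GCtx} {Γ : Ctx} : Tm Ψ Γ .nat
  | succ {Ψ : GCtx} {Γ : Ctx} : Tm Ψ Γ .nat → Tm Ψ Γ .nat
  | lam {Ψ : GCtx} {Γ : Ctx} {S T : Ty} : Tm Ψ (S :: Γ) T → Tm Ψ Γ (.arr S T)
  | app {Ψ : GCtx} {Γ : Ctx} {S T : Ty} : Tm Ψ Γ (.arr S T) → Tm Ψ Γ S → Tm Ψ Γ T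
  | box {Ψ : GCtx} {Γ : Ctx} {Δ : CCtx} {T : CTy} : Code Ψ Δ T → Tm Ψ Γ (.box Δ T)
  | letbox {Ψ : GCtx} {Γ : Ctx} {Δ : CCtx} {T : CTy} {T' : Ty} :
      Tm Ψ Γ (.box Δ T) → Tm (⟨Δ, T⟩ :: Ψ) Γ T' → Tm Ψ Γ T'
  | matchbox {Ψ : GCtx} {Γ : Ctx} {Δ : CCtx} {T : CTy} {T' : Ty} (s : Tm Ψ Γ (.box Δ T))
      (b : (p : Pat Δ T) → Tm (p.binds ++ Ψ) Γ T') : Tm Ψ Γ T'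

/-- Local substitutions of layer 0, `Ψ; Γ ⊢₀ δ : Δ`. -/
abbrev CSub (Ψ : GCtx) (Γ Δ : CCtx) : Type := Env (Code Ψ Γ) Δ

/-- Local substitutions of layer 1, `Ψ; Γ ⊢₁ δ : Δ`. -/
abbrev LSub (Ψ : GCtx) (Γ Δ : Ctx) : Type := Env (Tm Ψ Γ) Δ

/-- Local substitutions of layer 1 for a core context `Δ`. -/
abbrev LSubC (Ψ : GCtx) (Γ : Ctx) (Δ : CCtx) : Type := Env (fun A : CTy => Tm Ψ Γ A.emb) Δ

/-! ### Weakening of terms -/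

def Code.wk {Ψ Ψ' : GCtx} : {Γ Γ' : CCtx} → {T : CTy} →
    Wk Ψ' Ψ → Wk Γ' Γ → Code Ψ Γ T → Code Ψ' Γ' T
  | _, _, _, _, τ, .var x => .var (x.wk τ)
  | _, _, _, γ, τ, .gvar u δ => .gvar (u.wk γ) (fun A x => (δ A x).wk γ τ)
  | _, _, _, _, _, .zero => .zero
  | _, _, _, γ, τ, .succ t => .succ (t.wk γ τ)
  | _, _, _, γ, τ, .lam t => .lam (t.wk γ (.keep τ))
  | _, _, _, γ, τ, .app t s => .app (t.wk γ τ) (s.wk γ τ)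

def Tm.wk : {Ψ Ψ' : GCtx} → {Γ Γ' : Ctx} → {T : Ty} →
    Wk Ψ' Ψ → Wk Γ' Γ → Tm Ψ Γ T → Tm Ψ' Γ' T
  | _, _, _, _, _, _, τ, .var x => .var (x.wk τ)
  | _, _, _, _, _, γ, τ, .gvar u δ => .gvar (u.wk γ) (fun A x => (δ A x).wk γ τ)
  | _, _, _, _, _, _, _, .zero => .zero
  | _, _, _, _, _, γ, τ, .succ t => .succ (t.wk γ τ)
  | _, _, _, _, _, γ, τ, .lam t => .lam (t.wk γ (.keep τ))
  | _, _, _, _, _, γ, τ, .app t s => .app (t.wk γ τ) (s.wk γ τ)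
  | _, _, _, _, _, γ, _, .box c => .box (c.wk γ (Wk.id _))
  | _, _, _, _, _, γ, τ, .letbox s t => .letbox (s.wk γ τ) (t.wk (.keep γ) τ)
  | _, _, _, _, _, γ, τ, .matchbox s b =>
      .matchbox (s.wk γ τ) (fun p => (b p).wk (Wk.keeps p.binds γ) τ)

/-! ### Local substitutions -/

/-- Identity local substitution of layer 0. -/
def CSub.id (Ψ : GCtx) (Γ : CCtx) : CSub Ψ Γ Γ := fun _ x => .var x

/-- Identity local substitution of layer 1. -/
def LSub.id (Ψ : GCtx) (Γ : Ctx) : LSub Ψ Γ Γ := fun _ x => .var x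

/-- `δ, x/x`, at layer 0. -/
def CSub.lift {Ψ : GCtx} {Γ Δ : CCtx} {S : CTy} (δ : CSub Ψ Γ Δ) : CSub Ψ (S :: Γ) (S :: Δ) :=
  Env.cons (fun A x => (δ A x).wk (Wk.id _) (.drop (Wk.id _))) (.var .z)

/-- `δ, x/x`, at layer 1. -/
def LSub.lift {Ψ : GCtx} {Γ Δ : Ctx} {S : Ty} (δ : LSub Ψ Γ Δ) : LSub Ψ (S :: Γ) (S :: Δ) :=
  Env.cons (fun A x => (δ A x).wk (Wk.id _) (.drop (Wk.id _))) (.var .z)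

/-- `δ, x/x`, at layer 1, for a core context. -/
def LSubC.lift {Ψ : GCtx} {Γ : Ctx} {Δ : CCtx} {S : CTy} (δ : LSubC Ψ Γ Δ) :
    LSubC Ψ (S.emb :: Γ) (S :: Δ) :=
  Env.cons (X := fun A : CTy => Tm Ψ (S.emb :: Γ) A.emb)
    (fun A x => (δ A x).wk (Wk.id _) (.drop (Wk.id _))) (.var .z)

/-- `t[δ]` for `t` and `δ` of layer 0. -/
def Code.lsub {Ψ : GCtx} : {Γ Δ : CCtx} → {T : CTy} → Code Ψ Δ T → CSub Ψ Γ Δ → Code Ψ Γ T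
  | _, _, _, .var x, δ => δ _ x
  | _, _, _, .gvar u δ', δ => .gvar u (fun A x => (δ' A x).lsub δ)
  | _, _, _, .zero, _ => .zero
  | _, _, _, .succ t, δ => .succ (t.lsub δ)
  | _, _, _, .lam t, δ => .lam (t.lsub δ.lift)
  | _, _, _, .app t s, δ => .app (t.lsub δ) (s.lsub δ)

/-- `t[δ]` for `t` of layer 0, regarded as a term of layer 1 (lifting), and `δ` of layer 1. -/
def Code.inst {Ψ : GCtx} : {Γ : Ctx} → {Δ : CCtx} → {T : CTy} →
    Code Ψ Δ T → LSubC Ψ Γ Δ → Tm Ψ Γ T.emb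
  | _, _, _, .var x, δ => δ _ x
  | _, _, _, .gvar u δ', δ => .gvar u (fun A x => (δ' A x).inst δ)
  | _, _, _, .zero, _ => .zero
  | _, _, _, .succ t, δ => .succ (t.inst δ)
  | _, _, _, .lam t, δ => .lam (t.inst δ.lift)
  | _, _, _, .app t s, δ => .app (t.inst δ) (s.inst δ)

/-- `t[δ]` for `t` and `δ` of layer 1. -/
def Tm.lsub : {Ψ : GCtx} → {Γ Δ : Ctx} → {T : Ty} → Tm Ψ Δ T → LSub Ψ Γ Δ → Tm Ψ Γ T
  | _, _, _, _, .var x, δ => δ _ x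
  | _, _, _, _, .gvar u δ', δ => .gvar u (fun A x => (δ' A x).lsub δ)
  | _, _, _, _, .zero, _ => .zero
  | _, _, _, _, .succ t, δ => .succ (t.lsub δ)
  | _, _, _, _, .lam t, δ => .lam (t.lsub δ.lift)
  | _, _, _, _, .app t s, δ => .app (t.lsub δ) (s.lsub δ)
  | _, _, _, _, .box c, _ => .box c
  | _, _, _, _, .letbox s t, δ =>
      .letbox (s.lsub δ) (t.lsub (fun A x => (δ A x).wk (.drop (Wk.id _)) (Wk.id _)))
  | _, _, _, _, .matchbox s b, δ =>
      .matchbox (s.lsub δ)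
        (fun p => (b p).lsub (fun A x => (δ A x).wk (Wk.drops p.binds _) (Wk.id _)))

/-! ### Global substitutions -/

namespace GSub

/-- Identity global substitution, `u ↦ u^id`. -/
def id (Ψ : GCtx) : GSub Ψ Ψ := fun _ u => .gvar u (CSub.id _ _)

/-- `σ[γ]` for a global weakening `γ`. -/
def wk {Ψ' Ψ Φ : GCtx} (σ : GSub Ψ Φ) (γ : Wk Ψ' Ψ) : GSub Ψ' Φ :=
  fun B u => (σ B u).wk γ (Wk.id _)

/-- `σ, t/u`. -/
def ext {Ψ Φ : GCtx} {Δ : CCtx} {T : CTy} (σ : GSub Ψ Φ) (t : Code Ψ Δ T) :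
    GSub Ψ (⟨Δ, T⟩ :: Φ) :=
  Env.cons (X := fun B : GBind => Code Ψ B.ctx B.ty) σ t

/-- `σ, u/u`. -/
def lift {Ψ Φ : GCtx} {B : GBind} (σ : GSub Ψ Φ) : GSub (B :: Ψ) (B :: Φ) :=
  GSub.ext (σ.wk (.drop (Wk.id _))) (.gvar .z (CSub.id _ _))

/-- `σ, u₁/u₁, …, uₙ/uₙ` along a list of bindings. -/
def lifts : (l : GCtx) → {Ψ Φ : GCtx} → GSub Ψ Φ → GSub (l ++ Ψ) (l ++ Φ)
  | [], _, _, σ => σ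
  | _ :: l, _, _, σ => GSub.lift (lifts l σ)

/-- `σ` followed by the entries of `σ'`. -/
def append : (l : GCtx) → {Ψ Φ : GCtx} → GSub Ψ Φ → GSub Ψ l → GSub Ψ (l ++ Φ)
  | [], _, _, σ, _ => σ
  | B :: l, _, _, σ, σ' => GSub.ext (append l σ (fun _ u => σ' _ (.s u))) (σ' B .z)

end GSub

/-- `t[σ]` at layer 0. -/
def Code.gsub {Ψ Φ : GCtx} : {Γ : CCtx} → {T : CTy} → Code Φ Γ T → GSub Ψ Φ → Code Ψ Γ T
  | _, _, .var x, _ => .var x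
  | _, _, .gvar u δ, σ => (σ _ u).lsub (fun A x => (δ A x).gsub σ)
  | _, _, .zero, _ => .zero
  | _, _, .succ t, σ => .succ (t.gsub σ)
  | _, _, .lam t, σ => .lam (t.gsub σ)
  | _, _, .app t s, σ => .app (t.gsub σ) (s.gsub σ)

/-- `t[σ]` at layer 1. -/
def Tm.gsub : {Ψ Φ : GCtx} → {Γ : Ctx} → {T : Ty} → Tm Φ Γ T → GSub Ψ Φ → Tm Ψ Γ T
  | _, _, _, _, .var x, _ => .var x
  | _, _, _, _, .gvar u δ, σ => (σ _ u).inst (fun A x => (δ A x).gsub σ)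
  | _, _, _, _, .zero, _ => .zero
  | _, _, _, _, .succ t, σ => .succ (t.gsub σ)
  | _, _, _, _, .lam t, σ => .lam (t.gsub σ)
  | _, _, _, _, .app t s, σ => .app (t.gsub σ) (s.gsub σ)
  | _, _, _, _, .box c, σ => .box (c.gsub σ)
  | _, _, _, _, .letbox s t, σ => .letbox (s.gsub σ) (t.gsub σ.lift)
  | _, _, _, _, .matchbox s b, σ =>
      .matchbox (s.gsub σ) (fun p => (b p).gsub (GSub.lifts p.binds σ))

/-! ### Equivalence -/

/-- Equivalence at layer 0: symmetry, transitivity and congruence only. -/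
inductive CEquiv : {Ψ : GCtx} → {Γ : CCtx} → {T : CTy} → Code Ψ Γ T → Code Ψ Γ T → Prop
  | symm {Ψ : GCtx} {Γ : CCtx} {T : CTy} {s t : Code Ψ Γ T} : CEquiv s t → CEquiv t s
  | trans {Ψ : GCtx} {Γ : CCtx} {T : CTy} {s t r : Code Ψ Γ T} :
      CEquiv s t → CEquiv t r → CEquiv s r
  | var {Ψ : GCtx} {Γ : CCtx} {T : CTy} (x : Var Γ T) :
      CEquiv (Code.var (Ψ := Ψ) x) (Code.var x)
  | gvar {Ψ : GCtx} {Γ Δ : CCtx} {T : CTy} (u : Var Ψ ⟨Δ, T⟩) {δ δ' : CSub Ψ Γ Δ} :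
      (∀ A x, CEquiv (δ A x) (δ' A x)) → CEquiv (Code.gvar u δ) (Code.gvar u δ')
  | zero {Ψ : GCtx} {Γ : CCtx} : CEquiv (Code.zero (Ψ := Ψ) (Γ := Γ)) Code.zero
  | succ {Ψ : GCtx} {Γ : CCtx} {t t' : Code Ψ Γ .nat} :
      CEquiv t t' → CEquiv (Code.succ t) (Code.succ t')
  | lam {Ψ : GCtx} {Γ : CCtx} {S T : CTy} {t t' : Code Ψ (S :: Γ) T} :
      CEquiv t t' → CEquiv (Code.lam t) (Code.lam t')
  | app {Ψ : GCtx} {Γ : CCtx} {S T : CTy} {t t' : Code Ψ Γ (.arr S T)} {s s' : Code Ψ Γ S} :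
      CEquiv t t' → CEquiv s s' → CEquiv (Code.app t s) (Code.app t' s')

/-- Equivalence at layer 1, `Ψ; Γ ⊢₁ s ≈ t : T`. -/
inductive Equiv : {Ψ : GCtx} → {Γ : Ctx} → {T : Ty} → Tm Ψ Γ T → Tm Ψ Γ T → Prop
  | symm {Ψ : GCtx} {Γ : Ctx} {T : Ty} {s t : Tm Ψ Γ T} : Equiv s t → Equiv t s
  | trans {Ψ : GCtx} {Γ : Ctx} {T : Ty} {s t r : Tm Ψ Γ T} :
      Equiv s t → Equiv t r → Equiv s r
  | var {Ψ : GCtx} {Γ : Ctx} {T : Ty} (x : Var Γ T) :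
      Equiv (Tm.var (Ψ := Ψ) x) (Tm.var x)
  | gvar {Ψ : GCtx} {Γ : Ctx} {Δ : CCtx} {T : CTy} (u : Var Ψ ⟨Δ, T⟩) {δ δ' : LSubC Ψ Γ Δ} :
      (∀ A x, Equiv (δ A x) (δ' A x)) → Equiv (Tm.gvar u δ) (Tm.gvar u δ')
  | zero {Ψ : GCtx} {Γ : Ctx} : Equiv (Tm.zero (Ψ := Ψ) (Γ := Γ)) Tm.zero
  | succ {Ψ : GCtx} {Γ : Ctx} {t t' : Tm Ψ Γ .nat} :
      Equiv t t' → Equiv (Tm.succ t) (Tm.succ t')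
  | lam {Ψ : GCtx} {Γ : Ctx} {S T : Ty} {t t' : Tm Ψ (S :: Γ) T} :
      Equiv t t' → Equiv (Tm.lam t) (Tm.lam t')
  | app {Ψ : GCtx} {Γ : Ctx} {S T : Ty} {t t' : Tm Ψ Γ (.arr S T)} {s s' : Tm Ψ Γ S} :
      Equiv t t' → Equiv s s' → Equiv (Tm.app t s) (Tm.app t' s')
  | box {Ψ : GCtx} {Γ : Ctx} {Δ : CCtx} {T : CTy} {c c' : Code Ψ Δ T} :
      CEquiv c c' → Equiv (Tm.box (Γ := Γ) c) (Tm.box c')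
  | letbox {Ψ : GCtx} {Γ : Ctx} {Δ : CCtx} {T : CTy} {T' : Ty} {s s' : Tm Ψ Γ (.box Δ T)}
      {t t' : Tm (⟨Δ, T⟩ :: Ψ) Γ T'} :
      Equiv s s' → Equiv t t' → Equiv (Tm.letbox s t) (Tm.letbox s' t')
  | matchbox {Ψ : GCtx} {Γ : Ctx} {Δ : CCtx} {T : CTy} {T' : Ty} {s s' : Tm Ψ Γ (.box Δ T)}
      {b b' : (p : Pat Δ T) → Tm (p.binds ++ Ψ) Γ T'} :
      Equiv s s' → (∀ p, Equiv (b p) (b' p)) → Equiv (Tm.matchbox s b) (Tm.matchbox s' b')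
  /-- `(λ x. t) s ≈ t[s/x]` -/
  | beta_lam {Ψ : GCtx} {Γ : Ctx} {S T : Ty} (t : Tm Ψ (S :: Γ) T) (s : Tm Ψ Γ S) :
      Equiv (Tm.app (Tm.lam t) s) (t.lsub (Env.cons (LSub.id Ψ Γ) s))
  /-- `letbox u = box s in t ≈ t[s/u]` -/
  | beta_letbox {Ψ : GCtx} {Γ : Ctx} {Δ : CCtx} {T : CTy} {T' : Ty} (s : Code Ψ Δ T)
      (t : Tm (⟨Δ, T⟩ :: Ψ) Γ T') :
      Equiv (Tm.letbox (Tm.box s) t) (t.gsub ((GSub.id Ψ).ext s))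
  /-- `match box x with b ≈ t` if `b(x)` is `var x ⇒ t` -/
  | beta_match_var {Ψ : GCtx} {Γ : Ctx} {Δ : CCtx} {T : CTy} {T' : Ty} (x : Var Δ T)
      (b : (p : Pat Δ T) → Tm (p.binds ++ Ψ) Γ T') :
      Equiv (Tm.matchbox (Tm.box (Code.var x)) b) (b (Pat.var x))
  /-- `match box zero with b ≈ t` if `b(zero)` is `zero ⇒ t` -/
  | beta_match_zero {Ψ : GCtx} {Γ : Ctx} {Δ : CCtx} {T' : Ty}
      (b : (p : Pat Δ .nat) → Tm (p.binds ++ Ψ) Γ T') :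
      Equiv (Tm.matchbox (Tm.box Code.zero) b) (b Pat.zero)
  /-- `match box (succ s) with b ≈ t[s/u]` if `b(succ s)` is `succ ?u ⇒ t` -/
  | beta_match_succ {Ψ : GCtx} {Γ : Ctx} {Δ : CCtx} {T' : Ty} (s : Code Ψ Δ .nat)
      (b : (p : Pat Δ .nat) → Tm (p.binds ++ Ψ) Γ T') :
      Equiv (Tm.matchbox (Tm.box (Code.succ s)) b) ((b Pat.succ).gsub ((GSub.id Ψ).ext s))
  /-- `match box (λ x. s) with b ≈ t[s/u]` if `b(λ x. s)` is `λ x. ?u ⇒ t` -/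
  | beta_match_lam {Ψ : GCtx} {Γ : Ctx} {Δ : CCtx} {S T : CTy} {T' : Ty} (s : Code Ψ (S :: Δ) T)
      (b : (p : Pat Δ (.arr S T)) → Tm (p.binds ++ Ψ) Γ T') :
      Equiv (Tm.matchbox (Tm.box (Code.lam s)) b) ((b Pat.lam).gsub ((GSub.id Ψ).ext s))
  /-- `match box (r s) with b ≈ t[r/u, s/u']` if `b(r s)` is `?u ?u' ⇒ t`, taken at the type `S`
  of `s` -/
  | beta_match_app {Ψ : GCtx} {Γ : Ctx} {Δ : CCtx} {S T : CTy} {T' : Ty}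
      (r : Code Ψ Δ (.arr S T)) (s : Code Ψ Δ S)
      (b : (p : Pat Δ T) → Tm (p.binds ++ Ψ) Γ T') :
      Equiv (Tm.matchbox (Tm.box (Code.app r s)) b)
        ((b (Pat.app S)).gsub (((GSub.id Ψ).ext r).ext s))
  /-- `t ≈ λ x. (t x)` -/
  | eta {Ψ : GCtx} {Γ : Ctx} {S T : Ty} (t : Tm Ψ Γ (.arr S T)) :
      Equiv t (Tm.lam (Tm.app (t.wk (Wk.id Ψ) (.drop (Wk.id Γ))) (Tm.var .z)))

/-! ### Normal and neutral forms -/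

mutual

/-- Normal forms `w ::= v | zero | succ w | box t | λ x. w`, where `t` is a term of layer 0. -/
inductive Nf : GCtx → Ctx → Ty → Type
  | ne {Ψ : GCtx} {Γ : Ctx} {T : Ty} : Ne Ψ Γ T → Nf Ψ Γ T
  | zero {Ψ : GCtx} {Γ : Ctx} : Nf Ψ Γ .nat
  | succ {Ψ : GCtx} {Γ : Ctx} : Nf Ψ Γ .nat → Nf Ψ Γ .nat
  | box {Ψ : GCtx} {Γ : Ctx} {Δ : CCtx} {T : CTy} : Code Ψ Δ T → Nf Ψ Γ (.box Δ T)
  | lam {Ψ : GCtx} {Γ : Ctx} {S T : Ty} : Nf Ψ (S :: Γ) T → Nf Ψ Γ (.arr S T)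

/-- Neutral forms
`v ::= x | u^θ | v w | letbox u = v in w | match v with r | match box u^δ with r`,
where `θ` is a normal local substitution, `r` are normal branches and `δ` is a local substitution of
layer 0. -/
inductive Ne : GCtx → Ctx → Ty → Type
  | var {Ψ : GCtx} {Γ : Ctx} {T : Ty} : Var Γ T → Ne Ψ Γ T
  | gvar {Ψ : GCtx} {Γ : Ctx} {Δ : CCtx} {T : CTy} (u : Var Ψ ⟨Δ, T⟩)
      (θ : (A : CTy) → Var Δ A → Nf Ψ Γ A.emb) : Ne Ψ Γ T.emb
  | app {Ψ : GCtx} {Γ : Ctx} {S T : Ty} : Ne Ψ Γ (.arr S T) → Nf Ψ Γ S → Ne Ψ Γ T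
  | letbox {Ψ : GCtx} {Γ : Ctx} {Δ : CCtx} {T : CTy} {T' : Ty} :
      Ne Ψ Γ (.box Δ T) → Nf (⟨Δ, T⟩ :: Ψ) Γ T' → Ne Ψ Γ T'
  | matchbox {Ψ : GCtx} {Γ : Ctx} {Δ : CCtx} {T : CTy} {T' : Ty} (v : Ne Ψ Γ (.box Δ T))
      (r : (p : Pat Δ T) → Nf (p.binds ++ Ψ) Γ T') : Ne Ψ Γ T'
  | matchgvar {Ψ : GCtx} {Γ : Ctx} {Δ Δ' : CCtx} {T : CTy} {T' : Ty} (u : Var Ψ ⟨Δ', T⟩)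
      (δ : (A : CTy) → Var Δ' A → Code Ψ Δ A)
      (r : (p : Pat Δ T) → Nf (p.binds ++ Ψ) Γ T') : Ne Ψ Γ T'

end

mutual

/-- A normal form as a term of layer 1. -/
def Nf.toTm : {Ψ : GCtx} → {Γ : Ctx} → {T : Ty} → Nf Ψ Γ T → Tm Ψ Γ T
  | _, _, _, .ne v => v.toTm
  | _, _, _, .zero => .zero
  | _, _, _, .succ w => .succ w.toTm
  | _, _, _, .box c => .box c
  | _, _, _, .lam w => .lam w.toTm

/-- A neutral form as a term of layer 1. -/
def Ne.toTm : {Ψ : GCtx} → {Γ : Ctx} → {T : Ty} → Ne Ψ Γ T → Tm Ψ Γ T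
  | _, _, _, .var x => .var x
  | _, _, _, .gvar u θ => .gvar u (fun A x => (θ A x).toTm)
  | _, _, _, .app v w => .app v.toTm w.toTm
  | _, _, _, .letbox v w => .letbox v.toTm w.toTm
  | _, _, _, .matchbox v r => .matchbox v.toTm (fun p => (r p).toTm)
  | _, _, _, .matchgvar u δ r => .matchbox (.box (.gvar u δ)) (fun p => (r p).toTm)

end

mutual

/-- Functorial action of weakenings on normal forms. -/
def Nf.wk : {Ψ Ψ' : GCtx} → {Γ Γ' : Ctx} → {T : Ty} →
    Wk Ψ' Ψ → Wk Γ' Γ → Nf Ψ Γ T → Nf Ψ' Γ' T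
  | _, _, _, _, _, γ, τ, .ne v => .ne (v.wk γ τ)
  | _, _, _, _, _, _, _, .zero => .zero
  | _, _, _, _, _, γ, τ, .succ w => .succ (w.wk γ τ)
  | _, _, _, _, _, γ, _, .box c => .box (c.wk γ (Wk.id _))
  | _, _, _, _, _, γ, τ, .lam w => .lam (w.wk γ (.keep τ))

/-- Functorial action of weakenings on neutral forms. -/
def Ne.wk : {Ψ Ψ' : GCtx} → {Γ Γ' : Ctx} → {T : Ty} →
    Wk Ψ' Ψ → Wk Γ' Γ → Ne Ψ Γ T → Ne Ψ' Γ' T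
  | _, _, _, _, _, _, τ, .var x => .var (x.wk τ)
  | _, _, _, _, _, γ, τ, .gvar u θ => .gvar (u.wk γ) (fun A x => (θ A x).wk γ τ)
  | _, _, _, _, _, γ, τ, .app v w => .app (v.wk γ τ) (w.wk γ τ)
  | _, _, _, _, _, γ, τ, .letbox v w => .letbox (v.wk γ τ) (w.wk (.keep γ) τ)
  | _, _, _, _, _, γ, τ, .matchbox v r =>
      .matchbox (v.wk γ τ) (fun p => (r p).wk (Wk.keeps p.binds γ) τ)
  | _, _, _, _, _, γ, τ, .matchgvar u δ r =>
      .matchgvar (u.wk γ) (fun A x => (δ A x).wk γ (Wk.id _))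
        (fun p => (r p).wk (Wk.keeps p.binds γ) τ)

end

/-! ### The presheaf model -/

/-- Interpretation of types: `Nat` and contextual types are interpreted by their normal forms,
function types by the exponential over weakenings. -/
def Sem : Ty → GCtx → Ctx → Type
  | .nat, Ψ, Γ => Nf Ψ Γ .nat
  | .box Δ T, Ψ, Γ => Nf Ψ Γ (.box Δ T)
  | .arr S T, Ψ, Γ => (Φ : GCtx) → (Δ : Ctx) → Wk Φ Ψ → Wk Δ Γ → Sem S Φ Δ → Sem T Φ Δ

/-- Functorial action of weakenings on the interpretation of a type. -/
def Sem.wk : (T : Ty) → {Ψ Ψ' : GCtx} → {Γ Γ' : Ctx} →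
    Wk Ψ' Ψ → Wk Γ' Γ → Sem T Ψ Γ → Sem T Ψ' Γ'
  | .nat, _, _, _, _, γ, τ, a => Nf.wk γ τ a
  | .box _ _, _, _, _, _, γ, τ, a => Nf.wk γ τ a
  | .arr _ _, _, _, _, _, γ, τ, a => fun Φ Δ γ' τ' b => a Φ Δ (γ.comp γ') (τ.comp τ') b

/-- Interpretation of local contexts. -/
abbrev SemCtx (Δ : Ctx) (Ψ : GCtx) (Γ : Ctx) : Type := Env (fun A : Ty => Sem A Ψ Γ) Δ

/-- Interpretation of core local contexts. -/
abbrev SemCCtx (Δ : CCtx) (Ψ : GCtx) (Γ : Ctx) : Type := Env (fun A : CTy => Sem A.emb Ψ Γ) Δ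

def SemCtx.wk {Δ : Ctx} {Ψ Ψ' : GCtx} {Γ Γ' : Ctx} (ρ : SemCtx Δ Ψ Γ) (γ : Wk Ψ' Ψ)
    (τ : Wk Γ' Γ) : SemCtx Δ Ψ' Γ' :=
  fun A x => Sem.wk A γ τ (ρ A x)

def SemCCtx.wk {Δ : CCtx} {Ψ Ψ' : GCtx} {Γ Γ' : Ctx} (ρ : SemCCtx Δ Ψ Γ) (γ : Wk Ψ' Ψ)
    (τ : Wk Γ' Γ) : SemCCtx Δ Ψ' Γ' :=
  fun A x => Sem.wk A.emb γ τ (ρ A x)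

def SemCtx.ext {Δ : Ctx} {Ψ : GCtx} {Γ : Ctx} {S : Ty} (ρ : SemCtx Δ Ψ Γ) (a : Sem S Ψ Γ) :
    SemCtx (S :: Δ) Ψ Γ :=
  Env.cons (X := fun A : Ty => Sem A Ψ Γ) ρ a

def SemCCtx.ext {Δ : CCtx} {Ψ : GCtx} {Γ : Ctx} {S : CTy} (ρ : SemCCtx Δ Ψ Γ)
    (a : Sem S.emb Ψ Γ) : SemCCtx (S :: Δ) Ψ Γ :=
  Env.cons (X := fun A : CTy => Sem A.emb Ψ Γ) ρ a

mutual

/-- Reification. -/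
def reify : (T : Ty) → {Ψ : GCtx} → {Γ : Ctx} → Sem T Ψ Γ → Nf Ψ Γ T
  | .nat, _, _, a => a
  | .box _ _, _, _, a => a
  | .arr S T, Ψ, Γ, a =>
      .lam (reify T (a Ψ (S :: Γ) (Wk.id Ψ) (.drop (Wk.id Γ)) (reflect S (.var .z))))

/-- Reflection. -/
def reflect : (T : Ty) → {Ψ : GCtx} → {Γ : Ctx} → Ne Ψ Γ T → Sem T Ψ Γ
  | .nat, _, _, v => Nf.ne v
  | .box _ _, _, _, v => Nf.ne v
  | .arr S T, _, _, v => fun _ _ γ τ a => reflect T (.app (v.wk γ τ) (reify S a))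

end

/-- Interpretation of the terms of layer 0, in an environment `(γ; ρ)` that consists of a global
weakening and an element of the interpretation of the local context. -/
def Code.eval {Φ : GCtx} : {Δ : CCtx} → {T : CTy} → Code Φ Δ T →
    {Ψ : GCtx} → {Γ : Ctx} → Wk Ψ Φ → SemCCtx Δ Ψ Γ → Sem T.emb Ψ Γ
  | _, _, .var x, _, _, _, ρ => ρ _ x
  | _, _, .gvar (T := T) u δ, _, _, γ, ρ =>
      reflect T.emb (.gvar (u.wk γ) (fun A x => reify A.emb ((δ A x).eval γ ρ)))
  | _, _, .zero, _, _, _, _ => Nf.zero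
  | _, _, .succ t, _, _, γ, ρ => Nf.succ (t.eval γ ρ)
  | _, _, .lam t, _, _, γ, ρ => fun _ _ γ' τ' a =>
      t.eval (γ.comp γ') ((SemCCtx.wk ρ γ' τ').ext a)
  | _, _, .app t s, Ψ, Γ, γ, ρ =>
      (t.eval γ ρ) Ψ Γ (Wk.id Ψ) (Wk.id Γ) (s.eval γ ρ)

/-- Case analysis on the head of a code: either one of the patterns matches, with the listed pieces of
code captured by its pattern variables, or the code is some `u^δ`. -/
def Code.caseHead {X : Type} {Ψ : GCtx} : {Δ : CCtx} → {T : CTy} → Code Ψ Δ T →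
    ((p : Pat Δ T) → GSub Ψ p.binds → X) →
    ((Δ' : CCtx) → Var Ψ ⟨Δ', T⟩ → CSub Ψ Δ Δ' → X) → X
  | _, _, .var x, k, _ => k (.var x) Env.nil
  | _, _, .zero, k, _ => k .zero Env.nil
  | _, _, .succ s, k, _ => k .succ (GSub.ext Env.nil s)
  | _, _, .lam s, k, _ => k .lam (GSub.ext Env.nil s)
  | _, _, .app (S := S) r s, k, _ => k (.app S) (GSub.ext (GSub.ext Env.nil r) s)
  | _, _, .gvar u δ, _, h => h _ u δ

/-- Interpretation of the terms of layer 1, in an environment `(σ; ρ)` that consists of a global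
substitution and an element of the interpretation of the local context. -/
def Tm.eval : {Φ : GCtx} → {Δ : Ctx} → {T : Ty} → Tm Φ Δ T →
    {Ψ : GCtx} → {Γ : Ctx} → GSub Ψ Φ → SemCtx Δ Ψ Γ → Sem T Ψ Γ
  | _, _, _, .var x, _, _, _, ρ => ρ _ x
  | _, _, _, .gvar u δ, Ψ, _, σ, ρ =>
      (σ _ u).eval (Wk.id Ψ) (fun A x => (δ A x).eval σ ρ)
  | _, _, _, .zero, _, _, _, _ => Nf.zero
  | _, _, _, .succ t, _, _, σ, ρ => Nf.succ (t.eval σ ρ)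
  | _, _, _, .lam t, _, _, σ, ρ => fun _ _ γ τ a =>
      t.eval (σ.wk γ) ((SemCtx.wk ρ γ τ).ext a)
  | _, _, _, .app t s, Ψ, Γ, σ, ρ =>
      (t.eval σ ρ) Ψ Γ (Wk.id Ψ) (Wk.id Γ) (s.eval σ ρ)
  | _, _, _, .box c, _, _, σ, _ => Nf.box (c.gsub σ)
  | _, _, T', .letbox (Δ := Δ') (T := T) s t, Ψ, Γ, σ, ρ =>
      match (s.eval σ ρ : Nf Ψ Γ (.box Δ' T)) with
      | .box c => t.eval (σ.ext c) ρ
      | .ne v => reflect T' (.letbox v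
          (reify T' (t.eval σ.lift (SemCtx.wk ρ (.drop (Wk.id Ψ)) (Wk.id Γ)))))
  | _, _, T', .matchbox (Δ := Δ') (T := T) s b, Ψ, Γ, σ, ρ =>
      -- the normal form of each branch
      let r : (p : Pat Δ' T) → Nf (p.binds ++ Ψ) Γ T' := fun p =>
        reify T' ((b p).eval (GSub.lifts p.binds σ)
          (SemCtx.wk ρ (Wk.drops p.binds Ψ) (Wk.id Γ)))
      match (s.eval σ ρ : Nf Ψ Γ (.box Δ' T)) with
      | .box c => c.caseHead
          (fun p σ' => (b p).eval (GSub.append p.binds σ σ') ρ)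
          (fun _ u δ => reflect T' (.matchgvar u δ r))
      | .ne v => reflect T' (.matchbox v r)

/-- The identity environment `↑^Γ`. -/
def idEnv (Ψ : GCtx) : (Γ : Ctx) → SemCtx Γ Ψ Γ
  | [] => Env.nil
  | T :: Γ => SemCtx.ext (SemCtx.wk (idEnv Ψ Γ) (Wk.id Ψ) (.drop (Wk.id Γ)))
      (reflect T (.var .z))

/-- Normalization by evaluation: reify the interpretation in the environment `(id; ↑^Γ)`. -/
def nbe {Ψ : GCtx} {Γ : Ctx} {T : Ty} (t : Tm Ψ Γ T) : Nf Ψ Γ T :=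
  reify T (t.eval (GSub.id Ψ) (idEnv Ψ Γ))

end LayeredCMTT

namespace LayeredCMTT

/-! ### Weakenings -/

namespace Wk

variable {α : Type}

@[simp] theorem id_comp : {Γ Δ : List α} → (γ : Wk Γ Δ) → (id Δ).comp γ = γ
  | _, _, .nil => rfl
  | _, _, .keep γ => congrArg keep (id_comp γ)
  | _, _, .drop γ => congrArg drop (id_comp γ)

@[simp] theorem comp_id : {Γ Δ : List α} → (γ : Wk Γ Δ) → γ.comp (id Γ) = γ
  | _, _, .nil => rfl
  | _, _, .keep γ => congrArg keep (comp_id γ)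
  | _, _, .drop γ => congrArg drop (comp_id γ)

@[simp] theorem comp_drop {Γ Δ Θ : List α} {a : α} (γ' : Wk Δ Θ) (γ : Wk Γ Δ) :
    γ'.comp (drop (a := a) γ) = drop (γ'.comp γ) := by
  cases γ' <;> rfl

@[simp] theorem keep_comp_keep {Γ Δ Θ : List α} {a : α} (γ' : Wk Δ Θ) (γ : Wk Γ Δ) :
    (keep (a := a) γ').comp (keep γ) = keep (γ'.comp γ) := rfl

@[simp] theorem drop_comp_keep {Γ Δ Θ : List α} {a : α} (γ' : Wk Δ Θ) (γ : Wk Γ Δ) :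
    (drop (a := a) γ').comp (keep γ) = drop (γ'.comp γ) := rfl

theorem keep_id (a : α) (Γ : List α) : keep (a := a) (id Γ) = id (a :: Γ) := rfl

@[simp] theorem keeps_id : (l Γ : List α) → keeps l (id Γ) = id (l ++ Γ)
  | [], _ => rfl
  | _ :: l, Γ => congrArg keep (keeps_id l Γ)

@[simp] theorem keeps_comp_keeps : (l : List α) → {Γ Δ Θ : List α} → (γ' : Wk Δ Θ) →
    (γ : Wk Γ Δ) → (keeps l γ').comp (keeps l γ) = keeps l (γ'.comp γ)
  | [], _, _, _, _, _ => rfl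
  | _ :: l, _, _, _, γ', γ => congrArg keep (keeps_comp_keeps l γ' γ)

theorem drops_comp_keeps : (l : List α) → {Γ Δ : List α} → (γ : Wk Γ Δ) →
    (drops l Δ).comp (keeps l γ) = γ.comp (drops l Γ)
  | [], _, _, γ => by simp [drops, keeps]
  | _ :: l, _, _, γ => by simp [drops, keeps, drops_comp_keeps l γ]

end Wk

namespace Var

variable {α : Type}

@[simp] theorem wk_id : {Γ : List α} → {a : α} → (x : Var Γ a) → x.wk (Wk.id Γ) = x
  | _, _, .z => rfl
  | _, _, .s x => congrArg s (wk_id x)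

@[simp] theorem wk_drop {Γ Δ : List α} {a b : α} (γ : Wk Γ Δ) (x : Var Δ a) :
    x.wk (.drop (a := b) γ) = .s (x.wk γ) := by
  cases x <;> rfl

@[simp] theorem wk_wk : {Γ Δ Θ : List α} → {a : α} → (γ' : Wk Δ Θ) → (γ : Wk Γ Δ) →
    (x : Var Θ a) → (x.wk γ').wk γ = x.wk (γ'.comp γ)
  | _, _, _, _, .nil, .nil, x => nomatch x
  | _, _, _, _, γ', .drop γ, x => by simp [wk_wk γ' γ x]
  | _, _, _, _, .keep _, .keep _, .z => rfl
  | _, _, _, _, .keep γ', .keep γ, .s x => congrArg s (wk_wk γ' γ x)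
  | _, _, _, _, .drop γ', .keep γ, x => by simp [Var.wk, wk_wk γ' γ x]

end Var

/-! ### Substitution calculus of layer 0 -/

namespace Code

theorem wk_id {Ψ : GCtx} {Γ : CCtx} {T : CTy} (c : Code Ψ Γ T) :
    c.wk (Wk.id Ψ) (Wk.id Γ) = c := by
  induction c with
  | var x => simp [wk]
  | gvar u δ ih => simp [wk, ih]
  | zero => rfl
  | succ t ih => simp [wk, ih]
  | lam t ih => simp [wk, Wk.keep_id, ih]
  | app t s iht ihs => simp [wk, iht, ihs]

theorem wk_wk {Ψ Ψ' Ψ'' : GCtx} {Γ Γ' Γ'' : CCtx} {T : CTy} (c : Code Ψ Γ T) (γ : Wk Ψ' Ψ)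
    (γ' : Wk Ψ'' Ψ') (τ : Wk Γ' Γ) (τ' : Wk Γ'' Γ') :
    (c.wk γ τ).wk γ' τ' = c.wk (γ.comp γ') (τ.comp τ') := by
  induction c generalizing Γ' Γ'' with
  | var x => simp [wk]
  | gvar u δ ih => simp [wk, ih]
  | zero => rfl
  | succ t ih => simp [wk, ih]
  | lam t ih => simp [wk, ih]
  | app t s iht ihs => simp [wk, iht, ihs]

theorem wk_lift {Ψ Ψ' : GCtx} {Γ Γ' Δ : CCtx} {S : CTy} (δ : CSub Ψ Γ Δ) (γ : Wk Ψ' Ψ)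
    (τ : Wk Γ' Γ) :
    (fun A x => (δ.lift (S := S) A x).wk γ (.keep τ)) =
      CSub.lift (fun A x => (δ A x).wk γ τ) := by
  funext A x
  cases x with
  | z => rfl
  | s x => simp [CSub.lift, Env.cons, wk_wk]

theorem lsub_wk {Ψ Ψ' : GCtx} {Γ Γ' Δ : CCtx} {T : CTy} (c : Code Ψ Δ T) (δ : CSub Ψ Γ Δ)
    (γ : Wk Ψ' Ψ) (τ : Wk Γ' Γ) :
    (c.lsub δ).wk γ τ = (c.wk γ (Wk.id Δ)).lsub (fun A x => (δ A x).wk γ τ) := by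
  induction c generalizing Γ Γ' with
  | var x => simp [wk, lsub]
  | gvar u δ ih => simp [wk, lsub, ih]
  | zero => rfl
  | succ t ih => simp [wk, lsub, ih]
  | lam t ih => simp [wk, lsub, Wk.keep_id, ih, wk_lift]
  | app t s iht ihs => simp [wk, lsub, iht, ihs]

theorem wk_lsub {Ψ : GCtx} {Γ Δ Δ' : CCtx} {T : CTy} (c : Code Ψ Δ T) (δ : CSub Ψ Γ Δ')
    (τ : Wk Δ' Δ) :
    (c.wk (Wk.id Ψ) τ).lsub δ = c.lsub (fun A x => δ A (x.wk τ)) := by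
  induction c generalizing Γ Δ' with
  | var x => simp [wk, lsub]
  | gvar u δ ih => simp [wk, lsub, ih]
  | zero => rfl
  | succ t ih => simp [wk, lsub, ih]
  | lam t ih =>
    simp only [wk, lsub, ih]
    congr 2
    funext A x
    cases x <;> rfl
  | app t s iht ihs => simp [wk, lsub, iht, ihs]

theorem lsub_lift {Ψ : GCtx} {Γ Δ Θ : CCtx} {S : CTy} (δ : CSub Ψ Δ Θ) (δ' : CSub Ψ Γ Δ) :
    (fun A x => (δ.lift (S := S) A x).lsub δ'.lift) =
      CSub.lift (fun A x => (δ A x).lsub δ') := by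
  funext A x
  cases x with
  | z => rfl
  | s x => simp [CSub.lift, Env.cons, wk_lsub, lsub_wk, wk_id]

theorem lsub_lsub {Ψ : GCtx} {Γ Δ Θ : CCtx} {T : CTy} (c : Code Ψ Θ T) (δ : CSub Ψ Δ Θ)
    (δ' : CSub Ψ Γ Δ) : (c.lsub δ).lsub δ' = c.lsub (fun A x => (δ A x).lsub δ') := by
  induction c generalizing Γ Δ with
  | var x => rfl
  | gvar u δ ih => simp [lsub, ih]
  | zero => rfl
  | succ t ih => simp [lsub, ih]
  | lam t ih => simp [lsub, ih, lsub_lift]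
  | app t s iht ihs => simp [lsub, iht, ihs]

@[simp] theorem lift_id {Ψ : GCtx} {Γ : CCtx} {S : CTy} :
    (CSub.id Ψ Γ).lift (S := S) = CSub.id Ψ (S :: Γ) := by
  funext A x
  cases x <;> simp [CSub.lift, Env.cons, CSub.id, wk]

@[simp] theorem lsub_id {Ψ : GCtx} {Γ : CCtx} {T : CTy} (c : Code Ψ Γ T) :
    c.lsub (CSub.id Ψ Γ) = c := by
  induction c with
  | var x => rfl
  | gvar u δ ih => simp [lsub, ih]
  | zero => rfl
  | succ t ih => simp [lsub, ih]
  | lam t ih => simp [lsub, ih]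
  | app t s iht ihs => simp [lsub, iht, ihs]

theorem gsub_wk {Ψ Ψ' Φ : GCtx} {Γ Γ' : CCtx} {T : CTy} (c : Code Φ Γ T) (σ : GSub Ψ Φ)
    (γ : Wk Ψ' Ψ) (τ : Wk Γ' Γ) :
    (c.gsub σ).wk γ τ = (c.wk (Wk.id Φ) τ).gsub (σ.wk γ) := by
  induction c generalizing Γ' with
  | var x => rfl
  | gvar u δ ih => simp [wk, gsub, lsub_wk, ih, GSub.wk]
  | zero => rfl
  | succ t ih => simp [wk, gsub, ih]
  | lam t ih => simp [wk, gsub, ih]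
  | app t s iht ihs => simp [wk, gsub, iht, ihs]

theorem wk_gsub {Ψ Φ Φ' : GCtx} {Γ : CCtx} {T : CTy} (c : Code Φ Γ T) (σ : GSub Ψ Φ')
    (γ : Wk Φ' Φ) :
    (c.wk γ (Wk.id Γ)).gsub σ = c.gsub (fun B u => σ B (u.wk γ)) := by
  induction c with
  | var x => simp [wk, gsub]
  | gvar u δ ih => simp [wk, gsub, ih]
  | zero => rfl
  | succ t ih => simp [wk, gsub, ih]
  | lam t ih => simp [wk, gsub, Wk.keep_id, ih]
  | app t s iht ihs => simp [wk, gsub, iht, ihs]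

end Code

@[simp] theorem GSub.wk_id {Ψ Φ : GCtx} (σ : GSub Ψ Φ) : σ.wk (Wk.id Ψ) = σ := by
  funext B u
  simp [GSub.wk, Code.wk_id]

namespace Code

theorem gsub_lift {Ψ Φ : GCtx} {Γ Δ : CCtx} {S : CTy} (δ : CSub Φ Γ Δ) (σ : GSub Ψ Φ) :
    (fun A x => (δ.lift (S := S) A x).gsub σ) = CSub.lift (fun A x => (δ A x).gsub σ) := by
  funext A x
  cases x with
  | z => rfl
  | s x => simp [CSub.lift, Env.cons, gsub_wk]

theorem gsub_lsub {Ψ Φ : GCtx} {Γ Δ : CCtx} {T : CTy} (c : Code Φ Δ T) (δ : CSub Φ Γ Δ)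
    (σ : GSub Ψ Φ) :
    (c.lsub δ).gsub σ = (c.gsub σ).lsub (fun A x => (δ A x).gsub σ) := by
  induction c generalizing Γ with
  | var x => rfl
  | gvar u δ ih => simp [lsub, gsub, lsub_lsub, ih]
  | zero => rfl
  | succ t ih => simp [lsub, gsub, ih]
  | lam t ih => simp [lsub, gsub, ih, gsub_lift]
  | app t s iht ihs => simp [lsub, gsub, iht, ihs]

theorem gsub_gsub {Ψ Φ Θ : GCtx} {Γ : CCtx} {T : CTy} (c : Code Θ Γ T) (σ : GSub Φ Θ)
    (σ' : GSub Ψ Φ) : (c.gsub σ).gsub σ' = c.gsub (fun B u => (σ B u).gsub σ') := by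
  induction c with
  | var x => rfl
  | gvar u δ ih => simp [gsub, gsub_lsub, ih]
  | zero => rfl
  | succ t ih => simp [gsub, ih]
  | lam t ih => simp [gsub, ih]
  | app t s iht ihs => simp [gsub, iht, ihs]

@[simp] theorem gsub_id {Ψ : GCtx} {Γ : CCtx} {T : CTy} (c : Code Ψ Γ T) :
    c.gsub (GSub.id Ψ) = c := by
  induction c with
  | var x => rfl
  | gvar u δ ih => simp [gsub, GSub.id, lsub, CSub.id, ih]
  | zero => rfl
  | succ t ih => simp [gsub, ih]
  | lam t ih => simp [gsub, ih]
  | app t s iht ihs => simp [gsub, iht, ihs]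

end Code

/-! ### Global substitutions -/

namespace GSub

theorem id_wk {Ψ Ψ' : GCtx} (γ : Wk Ψ' Ψ) :
    (id Ψ).wk γ = fun B u => id Ψ' B (u.wk γ) := by
  funext B u
  simp only [GSub.wk, id, Code.wk]
  congr 1
  funext A x
  simp [CSub.id, Code.wk]

theorem wk_lift {Ψ Ψ' Φ : GCtx} {B : GBind} (σ : GSub Ψ Φ) (γ : Wk Ψ' Ψ) :
    (σ.lift (B := B)).wk (.keep γ) = (σ.wk γ).lift := by
  funext C u
  cases u with
  | z =>
    simp [GSub.wk, lift, ext, Env.cons, Code.wk, Var.wk, CSub.id]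
    rfl
  | s u => simp [GSub.wk, lift, ext, Env.cons, Code.wk_wk]

theorem wk_lifts : (l : GCtx) → {Ψ Ψ' Φ : GCtx} → (σ : GSub Ψ Φ) → (γ : Wk Ψ' Ψ) →
    (lifts l σ).wk (Wk.keeps l γ) = lifts l (σ.wk γ)
  | [], _, _, _, _, _ => rfl
  | _ :: l, _, _, _, σ, γ => by simp [lifts, Wk.keeps, wk_lift, wk_lifts l σ γ]

theorem lift_comp_keep {Ψ Φ Φ' : GCtx} {B : GBind} (σ : GSub Ψ Φ') (γ : Wk Φ' Φ) :
    (fun C u => σ.lift (B := B) C (u.wk (.keep γ))) = lift (fun C u => σ C (u.wk γ)) := by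
  funext C u
  cases u <;> rfl

theorem lifts_comp_keeps : (l : GCtx) → {Ψ Φ Φ' : GCtx} → (σ : GSub Ψ Φ') → (γ : Wk Φ' Φ) →
    (fun C u => lifts l σ C (u.wk (Wk.keeps l γ))) = lifts l (fun C u => σ C (u.wk γ))
  | [], _, _, _, _, _ => rfl
  | _ :: l, _, _, _, σ, γ => by
    simp only [lifts, Wk.keeps]
    rw [← lifts_comp_keeps l σ γ]
    exact lift_comp_keep _ _

theorem lifts_comp_drops : (l : GCtx) → {Ψ Φ : GCtx} → (σ : GSub Ψ Φ) →
    (fun C u => lifts l σ C (u.wk (Wk.drops l Φ))) = σ.wk (Wk.drops l Ψ)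
  | [], _, _, _ => by simp [lifts, Wk.drops]
  | _ :: l, _, _, σ => by
    have h := lifts_comp_drops l σ
    funext C u
    have hu : lifts l σ C (u.wk (Wk.drops l _)) = _ := congrFun (congrFun h C) u
    simp only [lifts, Wk.drops, Var.wk_drop, lift, ext, Env.cons, GSub.wk] at hu ⊢
    simp [hu, Code.wk_wk]

theorem gsub_lift {Ψ Φ Θ : GCtx} {B : GBind} (σ : GSub Φ Θ) (σ' : GSub Ψ Φ) :
    (fun C u => (σ.lift (B := B) C u).gsub σ'.lift) = lift (fun C u => (σ C u).gsub σ') := by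
  funext C u
  cases u with
  | z =>
    simp [lift, ext, Env.cons, Code.gsub, CSub.id, Code.lsub]
    rfl
  | s u =>
    simp only [lift, ext, Env.cons, GSub.wk, Code.wk_gsub, Code.gsub_wk, Code.wk_id]
    congr 1
    funext D v
    simp only [Var.wk_drop, Var.wk_id]
    rfl

theorem gsub_lifts : (l : GCtx) → {Ψ Φ Θ : GCtx} → (σ : GSub Φ Θ) → (σ' : GSub Ψ Φ) →
    (fun C u => (lifts l σ C u).gsub (lifts l σ')) = lifts l (fun C u => (σ C u).gsub σ')
  | [], _, _, _, _, _ => rfl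
  | _ :: l, _, _, _, σ, σ' => by
    simp only [lifts]
    rw [← gsub_lifts l σ σ']
    exact gsub_lift _ _

@[simp] theorem lift_id {Ψ : GCtx} {B : GBind} : (id Ψ).lift (B := B) = id (B :: Ψ) := by
  funext C u
  cases u with
  | z => rfl
  | s u =>
    rw [lift, id_wk]
    simp [ext, Env.cons, id]

@[simp] theorem lifts_id : (l Ψ : GCtx) → lifts l (id Ψ) = id (l ++ Ψ)
  | [], _ => rfl
  | _ :: l, Ψ => by simp [lifts, lifts_id l Ψ]

end GSub

/-! ### Substitution calculus of layer 1 -/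

namespace Tm

theorem wk_id {Ψ : GCtx} {Γ : Ctx} {T : Ty} (t : Tm Ψ Γ T) :
    t.wk (Wk.id Ψ) (Wk.id Γ) = t := by
  induction t with
  | var x => simp [wk]
  | gvar u δ ih => simp [wk, ih]
  | zero => rfl
  | succ t ih => simp [wk, ih]
  | lam t ih => simp [wk, Wk.keep_id, ih]
  | app t s iht ihs => simp [wk, iht, ihs]
  | box c => simp [wk, Code.wk_id]
  | letbox s t ihs iht => simp [wk, Wk.keep_id, ihs, iht]
  | matchbox s b ihs ihb => simp [wk, ihs, ihb]

theorem wk_wk {Ψ Ψ' Ψ'' : GCtx} {Γ Γ' Γ'' : Ctx} {T : Ty} (t : Tm Ψ Γ T) (γ : Wk Ψ' Ψ)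
    (γ' : Wk Ψ'' Ψ') (τ : Wk Γ' Γ) (τ' : Wk Γ'' Γ') :
    (t.wk γ τ).wk γ' τ' = t.wk (γ.comp γ') (τ.comp τ') := by
  induction t generalizing Ψ' Ψ'' Γ' Γ'' with
  | var x => simp [wk]
  | gvar u δ ih => simp [wk, ih]
  | zero => rfl
  | succ t ih => simp [wk, ih]
  | lam t ih => simp [wk, ih]
  | app t s iht ihs => simp [wk, iht, ihs]
  | box c => simp [wk, Code.wk_wk]
  | letbox s t ihs iht => simp [wk, ihs, iht]
  | matchbox s b ihs ihb => simp [wk, ihs, ihb]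

theorem wk_lift {Ψ Ψ' : GCtx} {Γ Γ' Δ : Ctx} {S : Ty} (δ : LSub Ψ Γ Δ) (γ : Wk Ψ' Ψ)
    (τ : Wk Γ' Γ) :
    (fun A x => (δ.lift (S := S) A x).wk γ (.keep τ)) =
      LSub.lift (fun A x => (δ A x).wk γ τ) := by
  funext A x
  cases x with
  | z => rfl
  | s x => simp [LSub.lift, Env.cons, wk_wk]

theorem lsub_wk {Ψ Ψ' : GCtx} {Γ Γ' Δ : Ctx} {T : Ty} (t : Tm Ψ Δ T) (δ : LSub Ψ Γ Δ)
    (γ : Wk Ψ' Ψ) (τ : Wk Γ' Γ) :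
    (t.lsub δ).wk γ τ = (t.wk γ (Wk.id Δ)).lsub (fun A x => (δ A x).wk γ τ) := by
  induction t generalizing Ψ' Γ Γ' with
  | var x => simp [wk, lsub]
  | gvar u δ ih => simp [wk, lsub, ih]
  | zero => rfl
  | succ t ih => simp [wk, lsub, ih]
  | lam t ih => simp [wk, lsub, Wk.keep_id, ih, wk_lift]
  | app t s iht ihs => simp [wk, lsub, iht, ihs]
  | box c => simp [wk, lsub]
  | letbox s t ihs iht => simp [wk, lsub, ihs, iht, wk_wk]
  | matchbox s b ihs ihb => simp [wk, lsub, ihs, ihb, wk_wk, Wk.drops_comp_keeps]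

theorem wk_lsub {Ψ : GCtx} {Γ Δ Δ' : Ctx} {T : Ty} (t : Tm Ψ Δ T) (δ : LSub Ψ Γ Δ')
    (τ : Wk Δ' Δ) :
    (t.wk (Wk.id Ψ) τ).lsub δ = t.lsub (fun A x => δ A (x.wk τ)) := by
  induction t generalizing Γ Δ' with
  | var x => simp [wk, lsub]
  | gvar u δ ih => simp [wk, lsub, ih]
  | zero => rfl
  | succ t ih => simp [wk, lsub, ih]
  | lam t ih =>
    simp only [wk, lsub, ih]
    congr 2
    funext A x
    cases x <;> rfl
  | app t s iht ihs => simp [wk, lsub, iht, ihs]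
  | box c => simp [wk, lsub, Code.wk_id]
  | letbox s t ihs iht => simp [wk, lsub, Wk.keep_id, ihs, iht]
  | matchbox s b ihs ihb => simp [wk, lsub, ihs, ihb]

theorem lsub_lift {Ψ : GCtx} {Γ Δ Θ : Ctx} {S : Ty} (δ : LSub Ψ Δ Θ) (δ' : LSub Ψ Γ Δ) :
    (fun A x => (δ.lift (S := S) A x).lsub δ'.lift) =
      LSub.lift (fun A x => (δ A x).lsub δ') := by
  funext A x
  cases x with
  | z => rfl
  | s x => simp [LSub.lift, Env.cons, wk_lsub, lsub_wk, wk_id]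

theorem lsub_lsub {Ψ : GCtx} {Γ Δ Θ : Ctx} {T : Ty} (t : Tm Ψ Θ T) (δ : LSub Ψ Δ Θ)
    (δ' : LSub Ψ Γ Δ) : (t.lsub δ).lsub δ' = t.lsub (fun A x => (δ A x).lsub δ') := by
  induction t generalizing Γ Δ with
  | var x => rfl
  | gvar u δ ih => simp [lsub, ih]
  | zero => rfl
  | succ t ih => simp [lsub, ih]
  | lam t ih => simp [lsub, ih, lsub_lift]
  | app t s iht ihs => simp [lsub, iht, ihs]
  | box c => rfl
  | letbox s t ihs iht => simp [lsub, ihs, iht, lsub_wk]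
  | matchbox s b ihs ihb => simp [lsub, ihs, ihb, lsub_wk]

@[simp] theorem lift_id {Ψ : GCtx} {Γ : Ctx} {S : Ty} :
    (LSub.id Ψ Γ).lift (S := S) = LSub.id Ψ (S :: Γ) := by
  funext A x
  cases x <;> simp [LSub.lift, Env.cons, LSub.id, wk]

theorem lsub_id {Ψ : GCtx} {Γ : Ctx} {T : Ty} (t : Tm Ψ Γ T) :
    t.lsub (LSub.id Ψ Γ) = t := by
  induction t with
  | var x => rfl
  | gvar u δ ih => simp [lsub, ih]
  | zero => rfl
  | succ t ih => simp [lsub, ih]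
  | lam t ih => simp [lsub, ih]
  | app t s iht ihs => simp [lsub, iht, ihs]
  | box c => rfl
  | letbox s t ihs iht =>
    simp only [lsub, ihs, letbox.injEq, heq_eq_eq, true_and]
    refine Eq.trans ?_ iht
    simp only [LSub.id, wk, Var.wk_id]
    rfl
  | matchbox s b ihs ihb =>
    simp only [lsub, ihs, matchbox.injEq, heq_eq_eq, true_and]
    funext p
    refine Eq.trans ?_ (ihb p)
    simp only [LSub.id, wk, Var.wk_id]
    rfl

end Tm

namespace Code

theorem wk_instLift {Ψ Ψ' : GCtx} {Γ Γ' : Ctx} {Δ : CCtx} {S : CTy} (δ : LSubC Ψ Γ Δ)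
    (γ : Wk Ψ' Ψ) (τ : Wk Γ' Γ) :
    (fun A x => (δ.lift (S := S) A x).wk γ (.keep τ)) =
      LSubC.lift (fun A x => (δ A x).wk γ τ) := by
  funext A x
  cases x with
  | z => rfl
  | s x => simp [LSubC.lift, Env.cons, Tm.wk_wk]

theorem inst_wk {Ψ Ψ' : GCtx} {Γ Γ' : Ctx} {Δ : CCtx} {T : CTy} (c : Code Ψ Δ T)
    (δ : LSubC Ψ Γ Δ) (γ : Wk Ψ' Ψ) (τ : Wk Γ' Γ) :
    (c.inst δ).wk γ τ = (c.wk γ (Wk.id Δ)).inst (fun A x => (δ A x).wk γ τ) := by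
  induction c generalizing Γ Γ' with
  | var x => simp [wk, inst]
  | gvar u δ ih => simp [wk, Tm.wk, inst, ih]
  | zero => rfl
  | succ t ih => exact congrArg Tm.succ (ih ..)
  | lam t ih => simp [wk, Tm.wk, inst, Wk.keep_id, ih, CTy.emb, wk_instLift]
  | app t s iht ihs => exact congrArg₂ Tm.app (iht ..) (ihs ..)

theorem wk_inst {Ψ : GCtx} {Γ : Ctx} {Δ Δ' : CCtx} {T : CTy} (c : Code Ψ Δ T)
    (δ : LSubC Ψ Γ Δ') (τ : Wk Δ' Δ) :
    (c.wk (Wk.id Ψ) τ).inst δ = c.inst (fun A x => δ A (x.wk τ)) := by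
  induction c generalizing Γ Δ' with
  | var x => simp [wk, inst]
  | gvar u δ ih => simp [wk, inst, ih]
  | zero => rfl
  | succ t ih => exact congrArg Tm.succ (ih ..)
  | lam t ih =>
    simp only [wk, inst, ih]
    congr 2
    funext A x
    cases x <;> rfl
  | app t s iht ihs => exact congrArg₂ Tm.app (iht ..) (ihs ..)

theorem inst_lift {Ψ : GCtx} {Γ : Ctx} {Δ Θ : CCtx} {S : CTy} (δ : CSub Ψ Δ Θ)
    (δ' : LSubC Ψ Γ Δ) :
    (fun A x => (δ.lift (S := S) A x).inst δ'.lift) =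
      LSubC.lift (fun A x => (δ A x).inst δ') := by
  funext A x
  cases x with
  | z => rfl
  | s x => simp [LSubC.lift, CSub.lift, Env.cons, wk_inst, inst_wk, wk_id]

theorem lsub_inst {Ψ : GCtx} {Γ : Ctx} {Δ Θ : CCtx} {T : CTy} (c : Code Ψ Θ T)
    (δ : CSub Ψ Δ Θ) (δ' : LSubC Ψ Γ Δ) :
    (c.lsub δ).inst δ' = c.inst (fun A x => (δ A x).inst δ') := by
  induction c generalizing Γ Δ with
  | var x => rfl
  | gvar u δ ih => simp [lsub, inst, ih]
  | zero => rfl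
  | succ t ih => exact congrArg Tm.succ (ih ..)
  | lam t ih => exact congrArg Tm.lam ((ih ..).trans (by rw [inst_lift]))
  | app t s iht ihs => exact congrArg₂ Tm.app (iht ..) (ihs ..)

theorem lsub_instLift {Ψ : GCtx} {Γ Δ : Ctx} {Θ : CCtx} {S : CTy} (δ : LSubC Ψ Δ Θ)
    (δ' : LSub Ψ Γ Δ) :
    (fun A x => (δ.lift (S := S) A x).lsub δ'.lift) =
      LSubC.lift (fun A x => (δ A x).lsub δ') := by
  funext A x
  cases x with
  | z => rfl
  | s x => simp [LSubC.lift, LSub.lift, Env.cons, Tm.wk_lsub, Tm.lsub_wk, Tm.wk_id]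

theorem inst_lsub {Ψ : GCtx} {Γ Δ : Ctx} {Θ : CCtx} {T : CTy} (c : Code Ψ Θ T)
    (δ : LSubC Ψ Δ Θ) (δ' : LSub Ψ Γ Δ) :
    (c.inst δ).lsub δ' = c.inst (fun A x => (δ A x).lsub δ') := by
  induction c generalizing Γ Δ with
  | var x => rfl
  | gvar u δ ih => simp [Tm.lsub, inst, ih]
  | zero => rfl
  | succ t ih => exact congrArg Tm.succ (ih ..)
  | lam t ih => simp [Tm.lsub, inst, ih, lsub_instLift, CTy.emb]
  | app t s iht ihs => exact congrArg₂ Tm.app (iht ..) (ihs ..)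

end Code

namespace Tm

theorem gsub_wk {Ψ Ψ' Φ : GCtx} {Γ Γ' : Ctx} {T : Ty} (t : Tm Φ Γ T) (σ : GSub Ψ Φ)
    (γ : Wk Ψ' Ψ) (τ : Wk Γ' Γ) :
    (t.gsub σ).wk γ τ = (t.wk (Wk.id Φ) τ).gsub (σ.wk γ) := by
  induction t generalizing Ψ Ψ' Γ' with
  | var x => rfl
  | gvar u δ ih => simp [wk, gsub, Code.inst_wk, ih, GSub.wk]
  | zero => rfl
  | succ t ih => simp [wk, gsub, ih]
  | lam t ih => simp [wk, gsub, ih]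
  | app t s iht ihs => simp [wk, gsub, iht, ihs]
  | box c => simp [wk, gsub, Code.gsub_wk]
  | letbox s t ihs iht => simp [wk, gsub, ihs, iht, Wk.keep_id, GSub.wk_lift]
  | matchbox s b ihs ihb => simp [wk, gsub, ihs, ihb, GSub.wk_lifts]

theorem wk_gsub {Ψ Φ Φ' : GCtx} {Γ : Ctx} {T : Ty} (t : Tm Φ Γ T) (σ : GSub Ψ Φ')
    (γ : Wk Φ' Φ) :
    (t.wk γ (Wk.id Γ)).gsub σ = t.gsub (fun B u => σ B (u.wk γ)) := by
  induction t generalizing Ψ Φ' with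
  | var x => simp [wk, gsub]
  | gvar u δ ih => simp [wk, gsub, ih]
  | zero => rfl
  | succ t ih => simp [wk, gsub, ih]
  | lam t ih => simp [wk, gsub, Wk.keep_id, ih]
  | app t s iht ihs => simp [wk, gsub, iht, ihs]
  | box c => simp [wk, gsub, Code.wk_gsub]
  | letbox s t ihs iht => simp [wk, gsub, ihs, iht, GSub.lift_comp_keep]
  | matchbox s b ihs ihb => simp [wk, gsub, ihs, ihb, GSub.lifts_comp_keeps]

theorem gsub_lift {Ψ Φ : GCtx} {Γ Δ : Ctx} {S : Ty} (δ : LSub Φ Γ Δ) (σ : GSub Ψ Φ) :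
    (fun A x => (δ.lift (S := S) A x).gsub σ) = LSub.lift (fun A x => (δ A x).gsub σ) := by
  funext A x
  cases x with
  | z => rfl
  | s x => simp [LSub.lift, Env.cons, gsub_wk]

theorem gsub_wk_drops {Ψ Φ : GCtx} {Γ : Ctx} {T : Ty} (l : GCtx) (t : Tm Φ Γ T)
    (σ : GSub Ψ Φ) :
    (t.wk (Wk.drops l Φ) (Wk.id Γ)).gsub (GSub.lifts l σ) =
      (t.gsub σ).wk (Wk.drops l Ψ) (Wk.id Γ) := by
  rw [wk_gsub, gsub_wk, wk_id, GSub.lifts_comp_drops]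

theorem gsub_wk_drop {Ψ Φ : GCtx} {Γ : Ctx} {T : Ty} {B : GBind} (t : Tm Φ Γ T)
    (σ : GSub Ψ Φ) :
    (t.wk (.drop (a := B) (Wk.id Φ)) (Wk.id Γ)).gsub σ.lift =
      (t.gsub σ).wk (.drop (Wk.id Ψ)) (Wk.id Γ) :=
  gsub_wk_drops [B] t σ

theorem gsub_lsub {Ψ Φ : GCtx} {Γ Δ : Ctx} {T : Ty} (t : Tm Φ Δ T) (δ : LSub Φ Γ Δ)
    (σ : GSub Ψ Φ) :
    (t.lsub δ).gsub σ = (t.gsub σ).lsub (fun A x => (δ A x).gsub σ) := by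
  induction t generalizing Ψ Γ with
  | var x => rfl
  | gvar u δ ih => simp [lsub, gsub, Code.inst_lsub, ih]
  | zero => rfl
  | succ t ih => simp [lsub, gsub, ih]
  | lam t ih => simp [lsub, gsub, ih, gsub_lift]
  | app t s iht ihs => simp [lsub, gsub, iht, ihs]
  | box c => rfl
  | letbox s t ihs iht => simp [lsub, gsub, ihs, iht, gsub_wk_drop]
  | matchbox s b ihs ihb => simp [lsub, gsub, ihs, ihb, gsub_wk_drops]

end Tm

namespace Code

theorem gsub_instLift {Ψ Φ : GCtx} {Γ : Ctx} {Δ : CCtx} {S : CTy} (δ : LSubC Φ Γ Δ)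
    (σ : GSub Ψ Φ) :
    (fun A x => (δ.lift (S := S) A x).gsub σ) = LSubC.lift (fun A x => (δ A x).gsub σ) := by
  funext A x
  cases x with
  | z => rfl
  | s x => simp [LSubC.lift, Env.cons, Tm.gsub_wk]

theorem inst_gsub {Ψ Φ : GCtx} {Γ : Ctx} {Δ : CCtx} {T : CTy} (c : Code Φ Δ T)
    (δ : LSubC Φ Γ Δ) (σ : GSub Ψ Φ) :
    (c.inst δ).gsub σ = (c.gsub σ).inst (fun A x => (δ A x).gsub σ) := by
  induction c generalizing Γ with
  | var x => rfl
  | gvar u δ ih => simp [Tm.gsub, gsub, inst, lsub_inst, ih]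
  | zero => rfl
  | succ t ih => exact congrArg Tm.succ (ih ..)
  | lam t ih => simp [Tm.gsub, gsub, inst, ih, gsub_instLift, CTy.emb]
  | app t s iht ihs => exact congrArg₂ Tm.app (iht ..) (ihs ..)

end Code

namespace Tm

theorem gsub_gsub {Ψ Φ Θ : GCtx} {Γ : Ctx} {T : Ty} (t : Tm Θ Γ T) (σ : GSub Φ Θ)
    (σ' : GSub Ψ Φ) : (t.gsub σ).gsub σ' = t.gsub (fun B u => (σ B u).gsub σ') := by
  induction t generalizing Ψ Φ with
  | var x => rfl
  | gvar u δ ih => simp [gsub, Code.inst_gsub, ih]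
  | zero => rfl
  | succ t ih => simp [gsub, ih]
  | lam t ih => simp [gsub, ih]
  | app t s iht ihs => simp [gsub, iht, ihs]
  | box c => simp [gsub, Code.gsub_gsub]
  | letbox s t ihs iht => simp [gsub, ihs, iht, GSub.gsub_lift]
  | matchbox s b ihs ihb => simp [gsub, ihs, ihb, GSub.gsub_lifts]

theorem gsub_id {Ψ : GCtx} {Γ : Ctx} {T : Ty} (t : Tm Ψ Γ T) : t.gsub (GSub.id Ψ) = t := by
  induction t with
  | var x => rfl
  | gvar u δ ih => simp [gsub, GSub.id, Code.inst, CSub.id, ih]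
  | zero => rfl
  | succ t ih => simp [gsub, ih]
  | lam t ih => simp [gsub, ih]
  | app t s iht ihs => simp [gsub, iht, ihs]
  | box c => simp [gsub]
  | letbox s t ihs iht => simp [gsub, ihs, iht]
  | matchbox s b ihs ihb => simp [gsub, ihs, ihb]

end Tm

namespace GSub

theorem append_wk_drops : (l : GCtx) → {Ψ Φ : GCtx} → (σ : GSub Ψ Φ) → (σ' : GSub Ψ l) →
    (fun B u => append l σ σ' B (u.wk (Wk.drops l Φ))) = σ
  | [], _, _, σ, _ => by simp [append, Wk.drops]
  | _ :: l, _, _, σ, σ' => by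
    simp only [Wk.drops, Var.wk_drop]
    exact append_wk_drops l σ (fun _ u => σ' _ (.s u))

theorem lifts_gsub_append : (l : GCtx) → {Ψ Φ : GCtx} → (σ : GSub Ψ Φ) → (σ' : GSub Ψ l) →
    (fun B u => (lifts l σ B u).gsub (append l (id Ψ) σ')) = append l σ σ'
  | [], _, _, σ, _ => by simp [append, lifts]
  | _ :: l, _, _, σ, σ' => by
    funext B u
    cases u with
    | z => exact Code.lsub_id _
    | s u =>
      simp only [lifts, lift, ext, append, Env.cons, GSub.wk, Code.wk_gsub, Var.wk_drop,
        Var.wk_id]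
      exact congrFun (congrFun (lifts_gsub_append l σ (fun _ u => σ' _ (.s u))) B) u

end GSub

theorem Tm.gsub_lifts_lsub_gsub_append {Ψ Φ : GCtx} {Γ Δ : Ctx} {T : Ty} (l : GCtx)
    (t : Tm (l ++ Φ) Δ T) (σ : GSub Ψ Φ) (δ : LSub Ψ Γ Δ) (σ' : GSub Ψ l) :
    ((t.gsub (GSub.lifts l σ)).lsub (fun A x => (δ A x).wk (Wk.drops l Ψ) (Wk.id Γ))).gsub
      (GSub.append l (GSub.id Ψ) σ') = (t.gsub (GSub.append l σ σ')).lsub δ := by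
  simp only [gsub_lsub, gsub_gsub, wk_gsub, GSub.append_wk_drops, gsub_id,
    GSub.lifts_gsub_append]

/-! ### Closure properties of equivalence -/

theorem CEquiv.eq {Ψ : GCtx} {Γ : CCtx} {T : CTy} {s t : Code Ψ Γ T} (h : CEquiv s t) :
    s = t := by
  induction h with
  | symm _ ih => exact ih.symm
  | trans _ _ ih₁ ih₂ => exact ih₁.trans ih₂
  | var x => rfl
  | gvar u _ ih => exact congrArg (Code.gvar u) (funext fun A => funext fun x => ih A x)
  | zero => rfl
  | succ _ ih => rw [ih]
  | lam _ ih => rw [ih]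
  | app _ _ ih₁ ih₂ => rw [ih₁, ih₂]

theorem CEquiv.refl {Ψ : GCtx} {Γ : CCtx} {T : CTy} (c : Code Ψ Γ T) : CEquiv c c := by
  induction c with
  | var x => exact .var x
  | gvar u δ ih => exact .gvar u ih
  | zero => exact .zero
  | succ t ih => exact .succ ih
  | lam t ih => exact .lam ih
  | app t s iht ihs => exact .app iht ihs

namespace Equiv

theorem refl {Ψ : GCtx} {Γ : Ctx} {T : Ty} (t : Tm Ψ Γ T) : Equiv t t := by
  induction t with
  | var x => exact .var x
  | gvar u δ ih => exact .gvar u ih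
  | zero => exact .zero
  | succ t ih => exact .succ ih
  | lam t ih => exact .lam ih
  | app t s iht ihs => exact .app iht ihs
  | box c => exact .box (.refl c)
  | letbox s t ihs iht => exact .letbox ihs iht
  | matchbox s b ihs ihb => exact .matchbox ihs ihb

theorem of_eq {Ψ : GCtx} {Γ : Ctx} {T : Ty} {s t : Tm Ψ Γ T} (h : s = t) : Equiv s t :=
  h ▸ refl s

end Equiv

theorem Tm.lsub_cons_wk {Ψ Ψ' : GCtx} {Γ Γ' : Ctx} {S T : Ty} (t : Tm Ψ (S :: Γ) T)
    (s : Tm Ψ Γ S) (γ : Wk Ψ' Ψ) (τ : Wk Γ' Γ) :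
    (t.lsub (Env.cons (LSub.id Ψ Γ) s)).wk γ τ =
      (t.wk γ (.keep τ)).lsub (Env.cons (LSub.id Ψ' Γ') (s.wk γ τ)) := by
  have h := Tm.wk_wk t γ (Wk.id Ψ') (Wk.id (S :: Γ)) (.keep τ)
  simp only [Wk.comp_id, Wk.id_comp] at h
  rw [lsub_wk, ← h, wk_lsub]
  congr 1
  funext A x
  cases x <;> rfl

theorem Tm.gsub_append_wk {Ψ Ψ' : GCtx} {Γ Γ' : Ctx} {T : Ty} (l : GCtx)
    (t : Tm (l ++ Ψ) Γ T) (σ : GSub Ψ l) (γ : Wk Ψ' Ψ) (τ : Wk Γ' Γ) :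
    (t.gsub (GSub.append l (GSub.id Ψ) σ)).wk γ τ =
      (t.wk (Wk.keeps l γ) τ).gsub (GSub.append l (GSub.id Ψ') (σ.wk γ)) := by
  have h := Tm.wk_wk t (Wk.id _) (Wk.keeps l γ) τ (Wk.id Γ')
  simp only [Wk.comp_id, Wk.id_comp] at h
  rw [gsub_wk, ← h, wk_gsub]
  congr 1
  clear h t
  induction l with
  | nil => exact GSub.id_wk γ
  | cons B l ih =>
    funext C u
    cases u with
    | z => rfl
    | s u => exact congrFun (congrFun (ih (fun _ u => σ _ (.s u))) C) u

theorem Equiv.wk {Ψ Ψ' : GCtx} {Γ Γ' : Ctx} {T : Ty} {s t : Tm Ψ Γ T} (h : Equiv s t)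
    (γ : Wk Ψ' Ψ) (τ : Wk Γ' Γ) : Equiv (s.wk γ τ) (t.wk γ τ) := by
  induction h generalizing Ψ' Γ' with
  | symm _ ih => exact (ih γ τ).symm
  | trans _ _ ih₁ ih₂ => exact (ih₁ γ τ).trans (ih₂ γ τ)
  | var x => exact .var _
  | gvar u _ ih => exact .gvar _ fun A x => ih A x γ τ
  | zero => exact .zero
  | succ _ ih => exact .succ (ih γ τ)
  | lam _ ih => exact .lam (ih γ τ.keep)
  | app _ _ ih₁ ih₂ => exact .app (ih₁ γ τ) (ih₂ γ τ)
  | box h => exact .of_eq (by rw [h.eq])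
  | letbox _ _ ih₁ ih₂ => exact .letbox (ih₁ γ τ) (ih₂ γ.keep τ)
  | matchbox _ _ ih₁ ih₂ => exact .matchbox (ih₁ γ τ) fun p => ih₂ p (Wk.keeps p.binds γ) τ
  | beta_lam t s => exact (Equiv.beta_lam _ _).trans (.of_eq (Tm.lsub_cons_wk t s γ τ).symm)
  | beta_letbox s t =>
    exact (Equiv.beta_letbox _ _).trans
      (.of_eq (Tm.gsub_append_wk [_] t (GSub.ext Env.nil s) γ τ).symm)
  | beta_match_var x b =>
    simp only [Tm.wk, Code.wk, Var.wk_id]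
    exact Equiv.beta_match_var x fun p => (b p).wk (Wk.keeps p.binds γ) τ
  | beta_match_zero b => exact Equiv.beta_match_zero fun p => (b p).wk (Wk.keeps p.binds γ) τ
  | beta_match_succ s b =>
    exact (Equiv.beta_match_succ _ fun p => (b p).wk (Wk.keeps p.binds γ) τ).trans
      (.of_eq (Tm.gsub_append_wk [_] (b .succ) (GSub.ext Env.nil s) γ τ).symm)
  | beta_match_lam s b =>
    exact (Equiv.beta_match_lam _ fun p => (b p).wk (Wk.keeps p.binds γ) τ).trans
      (.of_eq (Tm.gsub_append_wk [_] (b .lam) (GSub.ext Env.nil s) γ τ).symm)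
  | @beta_match_app Ψ Γ Δ S T T' r s b =>
    have h := (Tm.gsub_append_wk [⟨Δ, S⟩, ⟨Δ, .arr S T⟩] (b (.app S))
      (GSub.ext (GSub.ext Env.nil r) s) γ τ).symm
    exact (Equiv.beta_match_app _ _ fun p => (b p).wk (Wk.keeps p.binds γ) τ).trans (.of_eq h)
  | eta t =>
    refine (Equiv.eta _).trans (.of_eq ?_)
    simp [Tm.wk, Tm.wk_wk, Var.wk]

/-- Matching on a code that matches the pattern of some branch selects that branch; otherwise the
code is some `u^δ`. -/
theorem Code.caseHead_induction {Ψ : GCtx} {Γ : Ctx} {Δ : CCtx} {T : CTy} {T' : Ty} {X : Type}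
    (P : Code Ψ Δ T → X → Prop)
    (k : (p : Pat Δ T) → GSub Ψ p.binds → X)
    (h : (Δ' : CCtx) → Var Ψ ⟨Δ', T⟩ → CSub Ψ Δ Δ' → X)
    (hk : ∀ (c : Code Ψ Δ T) (p : Pat Δ T) (σ : GSub Ψ p.binds),
      (∀ b : (p : Pat Δ T) → Tm (p.binds ++ Ψ) Γ T',
        Equiv (Tm.matchbox (Tm.box c) b) ((b p).gsub (GSub.append p.binds (GSub.id Ψ) σ))) →
      P c (k p σ))
    (hh : ∀ Δ' u δ, P (Code.gvar u δ) (h Δ' u δ)) (c : Code Ψ Δ T) :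
    P c (c.caseHead k h) := by
  cases c with
  | var x =>
    exact hk _ _ _ fun b => (Equiv.beta_match_var x b).trans (.of_eq (Tm.gsub_id _).symm)
  | gvar u δ => exact hh _ u δ
  | zero => exact hk _ _ _ fun b => (Equiv.beta_match_zero b).trans (.of_eq (Tm.gsub_id _).symm)
  | succ s => exact hk _ _ _ fun b => Equiv.beta_match_succ s b
  | lam s => exact hk _ _ _ fun b => Equiv.beta_match_lam s b
  | app r s => exact hk _ _ _ fun b => Equiv.beta_match_app r s b

mutual

theorem Nf.toTm_wk {Ψ Ψ' : GCtx} {Γ Γ' : Ctx} {T : Ty} (γ : Wk Ψ' Ψ) (τ : Wk Γ' Γ) :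
    (w : Nf Ψ Γ T) → (w.wk γ τ).toTm = w.toTm.wk γ τ
  | .ne v => Ne.toTm_wk γ τ v
  | .zero => rfl
  | .succ w => congrArg Tm.succ (Nf.toTm_wk γ τ w)
  | .box _ => rfl
  | .lam w => congrArg Tm.lam (Nf.toTm_wk γ τ.keep w)

theorem Ne.toTm_wk {Ψ Ψ' : GCtx} {Γ Γ' : Ctx} {T : Ty} (γ : Wk Ψ' Ψ) (τ : Wk Γ' Γ) :
    (v : Ne Ψ Γ T) → (v.wk γ τ).toTm = v.toTm.wk γ τ
  | .var _ => rfl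
  | .gvar _ θ => congrArg (Tm.gvar _) (funext fun A => funext fun x => Nf.toTm_wk γ τ (θ A x))
  | .app v w => congrArg₂ Tm.app (Ne.toTm_wk γ τ v) (Nf.toTm_wk γ τ w)
  | .letbox v w => congrArg₂ Tm.letbox (Ne.toTm_wk γ τ v) (Nf.toTm_wk γ.keep τ w)
  | .matchbox v r => congrArg₂ Tm.matchbox (Ne.toTm_wk γ τ v)
      (funext fun p => Nf.toTm_wk (Wk.keeps p.binds γ) τ (r p))
  | .matchgvar _ _ r => congrArg (Tm.matchbox _)
      (funext fun p => Nf.toTm_wk (Wk.keeps p.binds γ) τ (r p))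

end

/-! ### The logical relation between terms and their interpretations -/

/-- `Rel T t a`: the term `t` is represented by the semantic value `a`. -/
def Rel : (T : Ty) → {Ψ : GCtx} → {Γ : Ctx} → Tm Ψ Γ T → Sem T Ψ Γ → Prop
  | .nat, _, _, t, a => Equiv t (Nf.toTm a)
  | .box _ _, _, _, t, a => Equiv t (Nf.toTm a)
  | .arr S T, Ψ, Γ, t, a => ∀ (Φ : GCtx) (Δ : Ctx) (γ : Wk Φ Ψ) (τ : Wk Δ Γ) (s : Tm Φ Δ S)
      (b : Sem S Φ Δ), Rel S s b → Rel T (.app (t.wk γ τ) s) (a Φ Δ γ τ b)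

namespace Rel

theorem of_equiv : (T : Ty) → {Ψ : GCtx} → {Γ : Ctx} → {t t' : Tm Ψ Γ T} → {a : Sem T Ψ Γ} →
    Equiv t t' → Rel T t' a → Rel T t a
  | .nat, _, _, _, _, _, h, r => h.trans r
  | .box _ _, _, _, _, _, _, h, r => h.trans r
  | .arr _ T, _, _, _, _, _, h, r => fun Φ Δ γ τ s b hb =>
    of_equiv T (.app (h.wk γ τ) (.refl s)) (r Φ Δ γ τ s b hb)

theorem wk : (T : Ty) → {Ψ Ψ' : GCtx} → {Γ Γ' : Ctx} → {t : Tm Ψ Γ T} → {a : Sem T Ψ Γ} →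
    Rel T t a → (γ : Wk Ψ' Ψ) → (τ : Wk Γ' Γ) → Rel T (t.wk γ τ) (Sem.wk T γ τ a)
  | .nat, _, _, _, _, _, _, r, γ, τ => (Equiv.wk r γ τ).trans (.of_eq (Nf.toTm_wk γ τ _).symm)
  | .box _ _, _, _, _, _, _, _, r, γ, τ => (Equiv.wk r γ τ).trans (.of_eq (Nf.toTm_wk γ τ _).symm)
  | .arr _ _, _, _, _, _, t, _, r, γ, τ => fun Φ Δ γ' τ' s b hb => by
    rw [Tm.wk_wk]
    exact r Φ Δ (γ.comp γ') (τ.comp τ') s b hb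

mutual

theorem reify : (T : Ty) → {Ψ : GCtx} → {Γ : Ctx} → {t : Tm Ψ Γ T} → {a : Sem T Ψ Γ} →
    Rel T t a → Equiv t (LayeredCMTT.reify T a).toTm
  | .nat, _, _, _, _, r => r
  | .box _ _, _, _, _, _, r => r
  | .arr S T, _, _, t, _, r => (Equiv.eta t).trans
    (.lam (reify T (r _ _ _ _ _ _ (reflect S (v := Ne.var .z) (Equiv.var .z)))))

theorem reflect : (T : Ty) → {Ψ : GCtx} → {Γ : Ctx} → {t : Tm Ψ Γ T} → {v : Ne Ψ Γ T} →
    Equiv t v.toTm → Rel T t (LayeredCMTT.reflect T v)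
  | .nat, _, _, _, _, h => h
  | .box _ _, _, _, _, _, h => h
  | .arr S T, _, _, _, v, h => fun _ _ γ τ _ _ hb =>
    reflect T (.app ((h.wk γ τ).trans (.of_eq (Ne.toTm_wk γ τ v).symm)) (reify S hb))

end

end Rel

/-! ### Fundamental lemmas -/

theorem Code.wk_inst_lift_lsub {Ψ : GCtx} {Γ : Ctx} {Δ : CCtx} {S T : CTy}
    (c : Code Ψ (S :: Δ) T) (δ : LSubC Ψ Γ Δ) (s : Tm Ψ Γ S.emb) :
    (c.inst δ.lift).lsub (Env.cons (LSub.id Ψ Γ) s) =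
      c.inst (Env.cons (X := fun A : CTy => Tm Ψ Γ A.emb) δ s) := by
  rw [Code.inst_lsub]
  congr 1
  funext A x
  cases x with
  | z => rfl
  | s x =>
    simp only [LSubC.lift, Env.cons, Tm.wk_lsub, Var.wk_drop, Var.wk_id]
    exact Tm.lsub_id _

theorem Tm.lsub_lift_lsub {Ψ : GCtx} {Γ Δ : Ctx} {S T : Ty}
    (t : Tm Ψ (S :: Δ) T) (δ : LSub Ψ Γ Δ) (s : Tm Ψ Γ S) :
    (t.lsub δ.lift).lsub (Env.cons (LSub.id Ψ Γ) s) = t.lsub (Env.cons δ s) := by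
  rw [Tm.lsub_lsub]
  congr 1
  funext A x
  cases x with
  | z => rfl
  | s x =>
    simp only [LSub.lift, Env.cons, Tm.wk_lsub, Var.wk_drop, Var.wk_id]
    exact Tm.lsub_id _

theorem Code.rel_eval {Φ : GCtx} {Δ : CCtx} {T : CTy} (c : Code Φ Δ T) {Ψ : GCtx} {Γ : Ctx}
    (γ : Wk Ψ Φ) (δ : LSubC Ψ Γ Δ) (ρ : SemCCtx Δ Ψ Γ)
    (h : ∀ A x, Rel A.emb (δ A x) (ρ A x)) :
    Rel T.emb ((c.wk γ (Wk.id Δ)).inst δ) (c.eval γ ρ) := by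
  induction c generalizing Ψ Γ with
  | var x => simpa [wk, inst, eval] using h _ x
  | gvar u δ' ih =>
    exact Rel.reflect _ (.gvar _ fun A x => Rel.reify _ (ih A x γ δ ρ h))
  | zero => exact Equiv.zero
  | succ t ih => exact Equiv.succ (ih γ δ ρ h)
  | lam t ih =>
    intro Ψ' Γ' γ' τ' s b hb
    refine Rel.of_equiv _ ?_ (ih (γ.comp γ')
      (Env.cons (X := fun A : CTy => Tm Ψ' Γ' A.emb) (fun A x => (δ A x).wk γ' τ') s)
      ((SemCCtx.wk ρ γ' τ').ext b) ?_)
    · refine (Equiv.beta_lam _ _).trans (.of_eq ?_)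
      rw [← Code.wk_inst_lift_lsub, ← Code.wk_instLift]
      simp only [Wk.keep_id, Code.inst_wk, Code.wk_wk, Wk.comp_id]
    · intro A x
      cases x with
      | z => exact hb
      | s x => exact (h A x).wk _ γ' τ'
  | app t s iht ihs =>
    exact Rel.of_equiv _ (.app (.of_eq (Tm.wk_id _).symm) (.refl _))
      (iht γ δ ρ h _ _ (Wk.id _) (Wk.id _) _ _ (ihs γ δ ρ h))

theorem Tm.rel_eval {Φ : GCtx} {Δ : Ctx} {T : Ty} (t : Tm Φ Δ T) {Ψ : GCtx} {Γ : Ctx}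
    (σ : GSub Ψ Φ) (δ : LSub Ψ Γ Δ) (ρ : SemCtx Δ Ψ Γ) (h : ∀ A x, Rel A (δ A x) (ρ A x)) :
    Rel T ((t.gsub σ).lsub δ) (t.eval σ ρ) := by
  induction t generalizing Ψ Γ with
  | var x => exact h _ x
  | gvar u δ' ih =>
    have := (σ _ u).rel_eval (Wk.id Ψ) _ _ fun A x => ih A x σ δ ρ h
    simp only [gsub, Code.inst_lsub]
    rwa [Code.wk_id] at this
  | zero => exact Equiv.zero
  | succ t ih => exact Equiv.succ (ih σ δ ρ h)
  | lam t ih =>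
    intro Ψ' Γ' γ τ s b hb
    refine Rel.of_equiv _ ?_ (ih (σ.wk γ) (Env.cons (fun A x => (δ A x).wk γ τ) s)
      ((SemCtx.wk ρ γ τ).ext b) ?_)
    · refine (Equiv.beta_lam _ _).trans (.of_eq ?_)
      rw [← Tm.lsub_lift_lsub (t.gsub (σ.wk γ)), ← Tm.wk_lift]
      simp only [Tm.lsub_wk, Tm.gsub_wk, Tm.wk_id]
    · intro A x
      cases x with
      | z => exact hb
      | s x => exact (h A x).wk _ γ τ
  | app t s iht ihs =>
    exact Rel.of_equiv _ (.app (.of_eq (Tm.wk_id _).symm) (.refl _))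
      (iht σ δ ρ h _ _ (Wk.id _) (Wk.id _) _ _ (ihs σ δ ρ h))
  | box c => exact Equiv.refl _
  | @letbox Φ Δ Δ' T T' s t ihs iht =>
    have hs : Equiv _ (Nf.toTm (s.eval σ ρ)) := ihs σ δ ρ h
    simp only [gsub, lsub, eval]
    generalize (s.eval σ ρ : Nf Ψ Γ (.box Δ' T)) = a at hs
    cases a with
    | box c =>
      refine Rel.of_equiv _ ((Equiv.letbox hs (.refl _)).trans ((Equiv.beta_letbox _ _).trans
        (.of_eq ?_))) (iht (σ.ext c) δ ρ h)
      exact Tm.gsub_lifts_lsub_gsub_append [_] t σ δ (GSub.ext Env.nil c)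
    | ne v =>
      exact Rel.reflect _ (.letbox hs (Rel.reify _ (iht σ.lift _ _ fun A x => (h A x).wk _ _ _)))
  | @matchbox Φ Δ Δ' T T' s b ihs ihb =>
    have hs : Equiv _ (Nf.toTm (s.eval σ ρ)) := ihs σ δ ρ h
    have hb := fun p : Pat Δ' T => Rel.reify _ (ihb p (GSub.lifts p.binds σ) _ _
      fun A x => (h A x).wk _ (Wk.drops p.binds Ψ) (Wk.id Γ))
    simp only [gsub, lsub, eval]
    generalize (s.eval σ ρ : Nf Ψ Γ (.box Δ' T)) = a at hs
    cases a with
    | box c =>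
      refine Rel.of_equiv _ (.matchbox hs fun _ => .refl _) ?_
      exact c.caseHead_induction (fun c x => Rel T' (.matchbox (.box c) _) x) _ _
        (fun c p σ' hc => Rel.of_equiv _
          ((hc _).trans (.of_eq (Tm.gsub_lifts_lsub_gsub_append p.binds (b p) σ δ σ')))
          (ihb p (GSub.append p.binds σ σ') δ ρ h))
        (fun _ u δ => Rel.reflect _ (.matchbox (.refl _) hb))
    | ne v => exact Rel.reflect _ (.matchbox hs hb)

theorem rel_idEnv (Ψ : GCtx) : (Γ : Ctx) → (A : Ty) → (x : Var Γ A) →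
    Rel A (LSub.id Ψ Γ A x) (idEnv Ψ Γ A x)
  | _ :: _, A, .z => Rel.reflect A (v := Ne.var .z) (Equiv.var .z)
  | B :: Γ, A, .s x => by
    have := (rel_idEnv Ψ Γ A x).wk A (Wk.id Ψ) (.drop (a := B) (Wk.id Γ))
    simp only [LSub.id, Tm.wk, Var.wk_drop, Var.wk_id] at this
    exact this

end LayeredCMTT

theorem mainTheorem1 (Ψ : LayeredCMTT.GCtx) (Γ : LayeredCMTT.Ctx) (T : LayeredCMTT.Ty)
    (t : LayeredCMTT.Tm Ψ Γ T) :
    LayeredCMTT.Equiv t (LayeredCMTT.nbe t).toTm := by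
  have h := LayeredCMTT.Rel.reify _
    (t.rel_eval (LayeredCMTT.GSub.id Ψ) _ _ (LayeredCMTT.rel_idEnv Ψ Γ))
  rwa [LayeredCMTT.Tm.gsub_id, LayeredCMTT.Tm.lsub_id] at h
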